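/- Let $H$ be a real Hilbert space and let $\phi\in C^1(H;\mathbb R)$ satisfy the quadratic lower bound: there are $\tau_*>0$ and $\phi_*\in\mathbb R$ with $\frac1{2\tau_*}|x|^2+\phi(x)\ge-\phi_*$ for every $x\in H$. A *solution* is a curve $u\in C^1([0,\infty);H)$ with $u'(t)=-\nabla\phi(u(t))$ for every $t\ge0$. For solutions $u,v$ write $u\succ v$ if $v([0,\infty))\subset\overline{u([0,\infty))}$ and there is $z:[0,\infty)\to[0,\infty)$ with $z(0)=0$, $0\le z(t)-z(s)\le t-s$ for $0\le s\le t$, and $u(t)=v(z(t))$ for every $t\ge0$. A solution $u$ is *minimal* if $u\succ v$ implies $u=v$ for every solution $v$. For $\psi:H\to\mathbb R$ let $\operatorname{Lip}[\psi]=\sup_{x\ne y}\frac{\psi(y)-\psi(x)}{|y-x|}\in[0,\infty]$. For $\tau,T>0$ let $N(\tau,T)=\min\{n\in\mathbb N:n\tau\ge T\}$. Let $\mathcal M_\tau(\psi,u_0)$ be the set of discrete solutions on $[0,\infty)$: the functions $U$ with $U(0)=u_0$ and $U(t)=U^n$ for $t\in((n-1)\tau,n\tau]$, $n\ge1$, where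 $U^0=u_0$ and $U^n$ minimizes $V\mapsto\frac1{2\tau}|V-U^{n-1}|^2+\psi(V)$ over $H$ for every $n\ge1$. Let $\mathcal M_\tau(\psi,u_0,T)$ be the set of functions $U:[0,T]\to H$ given in the same way on $[0,T]$ by finite sequences $(U^n)_{0\le n\le N(\tau,T)}$, with the minimality required for $1\le n\le N(\tau,T)$. Let $$d_T(u,v)=\sup_{t\in[0,T]}\big(|u(t)-v(t)|\wedge1\big),\qquad d_\infty(u,v)=\sup_{t\ge0}\frac{|u(t)-v(t)|\wedge1}{1+t},$$ and, for $T\in(0,\infty]$, $D_T(v,\mathcal W)=\sup_{w\in\mathcal W}d_T(v,w)$ if $\mathcal W\neq\emptyset$ and $D_T(v,\emptyset)=+\infty$. A family $\phi_\tau:H\to\mathbb R$ ($0<\tau<\tau_o$, for some $\tau_o>0$) *strongly approximates $u$ on every compact interval* if $\operatorname{Lip}[\phi_\tau-\phi]<\infty$ for all $\tau\in(0,\tau_o)$, $\lim_{\tau\downarrow0}\operatorname{Lip}[\phi_\tau-\phi]=0$, and $\lim_{\tau\downarrow0}D_T\big(u|_{[0,T]},\mathcal M_\tau(\phi_\tau,u(0),T)\big)=0$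 for every $T>0$. It *strongly approximates $u$ on $[0,\infty)$* if $\lim_{\tau\downarrow0}\operatorname{Lip}[\phi_\tau-\phi]=0$ and $\lim_{\tau\downarrow0}D_\infty\big(u,\mathcal M_\tau(\phi_\tau,u(0))\big)=0$. A solution $u$ is *strongly approximable* (on every compact interval, respectively on $[0,\infty)$) if such a family exists. **Theorem.** Every minimal solution $u$ is strongly approximable on every compact interval. If in addition $H$ has finite dimension or $\liminf_{t\to\infty}|\nabla\phi(u(t))|=0$, then $u$ is strongly approximable on $[0,\infty)$. Moreover, there are $\lambda(\tau)>0$ and $S(\tau)>0$ ($\tau>0$) with $\lambda(\tau)\to0$ and $S(\tau)\to\infty$ as $\tau\downarrow0$ such that both approximations (the second one under its additional assumption) are realized by the single family $$\phi_\tau(x)=\phi(x)+\lambda(\tau)\operatorname{dist}\big(x,\{u(n\tau):0\le n\le N(\tau,S(\tau))\}\big).$$ -/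

import Mathlib

/-! Curves `[0,∞) → H` (or `[0,T] → H`) are represented by functions `ℝ → H`; every notion below only
looks at their values on `[0,∞)` (or `[0,T]`). Distances and Lipschitz seminorms take values in
`[0,∞]`. -/

namespace MinMov

noncomputable section

variable {H : Type*} [NormedAddCommGroup H] [InnerProductSpace ℝ H]

/-- The Lipschitz seminorm `Lip[ψ] = sup_{x ≠ y} (ψ y - ψ x) / |y - x|`, equal to `∞` when `ψ` is not
Lipschitz. -/
def lip (ψ : H → ℝ) : ENNReal :=
  ⨆ (x : H) (y : H) (_ : x ≠ y), ENNReal.ofReal ((ψ y - ψ x) / ‖y - x‖)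

/-- The quadratic lower bound. -/
def QuadraticLowerBound (φ : H → ℝ) : Prop :=
  ∃ τs : ℝ, 0 < τs ∧ ∃ φs : ℝ, ∀ x : H, -φs ≤ 1 / (2 * τs) * ‖x‖ ^ 2 + φ x

/-- `u ∈ C¹([0,∞); H)` solves `u' = -∇φ(u)` in `[0,∞)` (one-sided derivative at `0`). -/
def IsSolution [CompleteSpace H] (φ : H → ℝ) (u : ℝ → H) : Prop :=
  ContDiffOn ℝ 1 u (Set.Ici 0) ∧
    ∀ t : ℝ, 0 ≤ t → HasDerivWithinAt u (-(gradient φ (u t))) (Set.Ici 0) t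

/-- The relation `u ≻ v` between curves on `[0,∞)`. -/
def Succeeds (u v : ℝ → H) : Prop :=
  v '' Set.Ici 0 ⊆ closure (u '' Set.Ici 0) ∧
    ∃ z : ℝ → ℝ, z 0 = 0 ∧
      (∀ s t : ℝ, 0 ≤ s → s ≤ t → 0 ≤ z t - z s ∧ z t - z s ≤ t - s) ∧
      ∀ t : ℝ, 0 ≤ t → u t = v (z t)

/-- Minimal solutions of the gradient flow. -/
def IsMinimalSolution [CompleteSpace H] (φ : H → ℝ) (u : ℝ → H) : Prop :=
  IsSolution φ u ∧
    ∀ v : ℝ → H, IsSolution φ v → Succeeds u v → Set.EqOn u v (Set.Ici 0)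

/-- `V n` minimizes `W ↦ |W - V (n-1)|² / (2τ) + ψ W` over `H`, for a step `n = k + 1`. -/
def IsMinStep (τ : ℝ) (ψ : H → ℝ) (V : ℕ → H) (k : ℕ) : Prop :=
  ∀ W : H, 1 / (2 * τ) * ‖V (k + 1) - V k‖ ^ 2 + ψ (V (k + 1))
    ≤ 1 / (2 * τ) * ‖W - V k‖ ^ 2 + ψ W

/-- Minimizing sequences `(V n)_{n ∈ ℕ}` with time step `τ` and initial value `u₀`. -/
def MS (τ : ℝ) (ψ : H → ℝ) (u₀ : H) : Set (ℕ → H) :=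
  {V | V 0 = u₀ ∧ ∀ k : ℕ, IsMinStep τ ψ V k}

/-- Finite minimizing sequences `(V n)_{0 ≤ n ≤ N}` (the values `V n`, `n > N`, are irrelevant). -/
def MSFin (τ : ℝ) (ψ : H → ℝ) (u₀ : H) (N : ℕ) : Set (ℕ → H) :=
  {V | V 0 = u₀ ∧ ∀ k : ℕ, k < N → IsMinStep τ ψ V k}

/-- `N(τ,T) = min {n ∈ ℕ : nτ ≥ T}`. -/
def numSteps (τ T : ℝ) : ℕ := sInf {n : ℕ | T ≤ n * τ}

/-- Discrete solutions on `[0,∞)`: `U 0 = u₀` and `U t = V n` for `t ∈ ((n-1)τ, nτ]`, `n ≥ 1`. -/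
def DS (τ : ℝ) (ψ : H → ℝ) (u₀ : H) : Set (ℝ → H) :=
  {U | ∃ V ∈ MS τ ψ u₀, U 0 = u₀ ∧
    ∀ k : ℕ, ∀ t ∈ Set.Ioc (k * τ) ((k + 1) * τ), U t = V (k + 1)}

/-- Discrete solutions on `[0,T]`. -/
def DSFin (τ : ℝ) (ψ : H → ℝ) (u₀ : H) (T : ℝ) : Set (ℝ → H) :=
  {U | ∃ V ∈ MSFin τ ψ u₀ (numSteps τ T), U 0 = u₀ ∧
    ∀ k : ℕ, ∀ t ∈ Set.Ioc (k * τ) ((k + 1) * τ), t ≤ T → U t = V (k + 1)}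

/-- `d_T(u,v) = sup_{t ∈ [0,T]} (|u t - v t| ∧ 1)`. -/
def dFin (T : ℝ) (u v : ℝ → H) : ENNReal :=
  ⨆ t ∈ Set.Icc 0 T, ENNReal.ofReal (min ‖u t - v t‖ 1)

/-- `d_∞(u,v) = sup_{t ≥ 0} (|u t - v t| ∧ 1) / (1 + t)`. -/
def dInf (u v : ℝ → H) : ENNReal :=
  ⨆ t ∈ Set.Ici (0 : ℝ), ENNReal.ofReal (1 / (1 + t) * min ‖u t - v t‖ 1)

open Classical in
/-- `D_T(v,𝒰) = sup_{w ∈ 𝒰} d_T(v,w)`, and `∞` if `𝒰` is empty. -/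
def DFin (T : ℝ) (v : ℝ → H) (𝒰 : Set (ℝ → H)) : ENNReal :=
  if 𝒰 = ∅ then ⊤ else ⨆ w ∈ 𝒰, dFin T v w

open Classical in
/-- `D_∞(v,𝒰) = sup_{w ∈ 𝒰} d_∞(v,w)`, and `∞` if `𝒰` is empty. -/
def DInf (v : ℝ → H) (𝒰 : Set (ℝ → H)) : ENNReal :=
  if 𝒰 = ∅ then ⊤ else ⨆ w ∈ 𝒰, dInf v w

/-- The perturbations `P τ` of `φ`, `τ ↓ 0`, strongly approximate `u` on `[0,∞)`. -/
def StronglyApproximates (φ : H → ℝ) (u : ℝ → H) (P : ℝ → H → ℝ) : Prop :=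
  Filter.Tendsto (fun τ => lip (fun x => P τ x - φ x)) (nhdsWithin 0 (Set.Ioi 0)) (nhds 0) ∧
  Filter.Tendsto (fun τ => DInf u (DS τ (P τ) (u 0))) (nhdsWithin 0 (Set.Ioi 0)) (nhds 0)

/-- The perturbations `P τ` of `φ`, `τ ∈ (0,τ₀)`, differ from `φ` by Lipschitz functions and strongly
approximate `u` on every compact interval `[0,T]`. -/
def StronglyApproximatesOnCompacts (φ : H → ℝ) (u : ℝ → H) (P : ℝ → H → ℝ) : Prop :=
  (∃ τ₀ : ℝ, 0 < τ₀ ∧ ∀ τ ∈ Set.Ioo 0 τ₀, lip (fun x => P τ x - φ x) < ⊤) ∧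
  Filter.Tendsto (fun τ => lip (fun x => P τ x - φ x)) (nhdsWithin 0 (Set.Ioi 0)) (nhds 0) ∧
  ∀ T : ℝ, 0 < T →
    Filter.Tendsto (fun τ => DFin T u (DSFin τ (P τ) (u 0) T)) (nhdsWithin 0 (Set.Ioi 0)) (nhds 0)

/-- `u` is a strongly approximable solution. -/
def IsStronglyApproximable [CompleteSpace H] (φ : H → ℝ) (u : ℝ → H) : Prop :=
  IsSolution φ u ∧ ∃ P : ℝ → H → ℝ, StronglyApproximates φ u P

/-- `u` is a solution that is strongly approximable in every compact interval. -/
def IsStronglyApproximableOnCompacts [CompleteSpace H] (φ : H → ℝ) (u : ℝ → H) : Prop :=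
  IsSolution φ u ∧ ∃ P : ℝ → H → ℝ, StronglyApproximatesOnCompacts φ u P

/-- The sampled range `{u(nτ) : 0 ≤ n ≤ N(τ,T)}`. -/
def sampledRange (u : ℝ → H) (τ T : ℝ) : Set H :=
  {x | ∃ n : ℕ, n ≤ numSteps τ T ∧ x = u (n * τ)}

/-- The distance penalization `φ + c · dist(·, {u(nτ) : 0 ≤ n ≤ N(τ,T)})`. -/
def penalized (φ : H → ℝ) (u : ℝ → H) (c τ T : ℝ) : H → ℝ :=
  fun x => φ x + c * Metric.infDist x (sampledRange u τ T)

end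

end MinMov

open Set Filter Topology MeasureTheory

namespace MinMov

section GradientFlow

variable {H : Type*} [NormedAddCommGroup H] [InnerProductSpace ℝ H] [CompleteSpace H]
  {φ : H → ℝ} {u : ℝ → H}

/-! ### Continuously differentiable functions on a Hilbert space -/

/-! The points `u (n * τ)` almost solve the implicit Euler scheme: by uniform continuity of the
gradient near a compact piece of the orbit, the residual of a step is at most `ε * τ`. A distance
penalty whose slope is a large enough multiple of `ε` outweighs this error, so minimizers are forced
onto the sample set, within `4 * ε * τ` of the next sample (`exists_isStep_and_forall_mem`). The
dissipated energy then shows that each step leads to a strictly later sample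
(`IsSolution.eventually_stepsFollow`). A discrete solution therefore never lags behind `u` before
the samples end; it can only skip ahead.

Skipping is where minimality enters. A skip covers a distance `O(ε * τ)` and hence dissipates energy
`O(ε * τ)`, but where the speed is small it may take much time. Elapsed time is at most slow time
plus dissipated energy over `δ` (`IsSolution.sub_le_slowTime`), so the total lead at time `T` is at
most the slow time plus `O(ε * T / δ)`. As `δ` tends to `0` the slow time vanishes exactly when the
critical times are null. For a minimal solution they are null until `u` becomes stationary:
otherwise stopping the clock at them yields a solution succeeded by `u`, hence `u` itself, and `u`
would repeat values in contradiction to energy decay (`IsMinimalSolution.ae_gradient_ne_zero`).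
Choosing `δ` first and `τ` afterwards gives closeness on bounded intervals
(`IsMinimalSolution.eventually_tracking`).

On the half-line the weight `1 / (1 + t)` reduces closeness to bounded intervals, and only existence
of infinite discrete solutions is missing. It follows from coercivity in finite dimension; if the
gradient has lower limit zero, the last sample is chosen almost critical, and the scheme stays there
forever. -/

theorem continuous_gradient (hφ : ContDiff ℝ 1 φ) : Continuous (gradient φ) :=
  (InnerProductSpace.toDual ℝ H).symm.continuous.comp (hφ.continuous_fderiv one_ne_zero)

theorem hasGradientAt_gradient (hφ : ContDiff ℝ 1 φ) (x : H) :
    HasGradientAt φ (gradient φ x) x :=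
  (hφ.differentiable one_ne_zero x).hasGradientAt

/-- Uniform continuity of the gradient near a compact set. -/
theorem exists_gradient_sub_le (hφ : ContDiff ℝ 1 φ) {K : Set H} (hK : IsCompact K) {ε : ℝ}
    (hε : 0 < ε) :
    ∃ δ > 0, ∀ p ∈ K, ∀ x : H, ‖x - p‖ ≤ δ → ‖gradient φ x - gradient φ p‖ ≤ ε := by
  have h := hK.uniformContinuousAt_of_continuousAt (gradient φ)
    (fun x _ => (continuous_gradient hφ).continuousAt) (Metric.dist_mem_uniformity hε)
  obtain ⟨δ, hδ, h⟩ := Metric.mem_uniformity_dist.1 h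
  refine ⟨δ / 2, half_pos hδ, fun p hp x hx => ?_⟩
  have h1 : dist p x < δ := by rw [dist_comm, dist_eq_norm]; linarith
  have h2 := h h1 hp
  simp only [mem_ofPred_eq] at h2
  rw [← dist_eq_norm, dist_comm]
  exact h2.le

/-- First order Taylor estimate around a point. -/
theorem abs_sub_inner_gradient_le (hφ : ContDiff ℝ 1 φ) {p : H} {δ ε : ℝ}
    (h : ∀ x : H, ‖x - p‖ ≤ δ → ‖gradient φ x - gradient φ p‖ ≤ ε) {x : H} (hx : ‖x - p‖ ≤ δ) :
    |φ x - φ p - inner ℝ (gradient φ p) (x - p)| ≤ ε * ‖x - p‖ := by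
  have h0 : 0 ≤ δ := (norm_nonneg _).trans hx
  have := (convex_closedBall p δ).norm_image_sub_le_of_norm_hasFDerivWithin_le' (f := φ)
    (f' := fun x => InnerProductSpace.toDual ℝ H (gradient φ x))
    (φ := InnerProductSpace.toDual ℝ H (gradient φ p)) (C := ε) (x := p) (y := x)
    (fun y _ => (hasGradientAt_gradient hφ y).hasFDerivAt.hasFDerivWithinAt)
    (fun y hy => by
      rw [← map_sub, LinearIsometryEquiv.norm_map]
      exact h y (by rwa [← dist_eq_norm]))
    (Metric.mem_closedBall_self h0) (by rwa [Metric.mem_closedBall, dist_eq_norm])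
  simpa using this

/-! ### Solutions of the gradient flow -/

namespace IsSolution

theorem continuousOn (hu : IsSolution φ u) : ContinuousOn u (Ici 0) := hu.1.continuousOn

theorem continuousOn_gradient (hφ : ContDiff ℝ 1 φ) (hu : IsSolution φ u) :
    ContinuousOn (fun t => gradient φ (u t)) (Ici 0) :=
  (continuous_gradient hφ).comp_continuousOn hu.continuousOn

theorem isCompact_image (hu : IsSolution φ u) (T : ℝ) : IsCompact (u '' Icc 0 T) :=
  isCompact_Icc.image_of_continuousOn (hu.continuousOn.mono fun _ h => h.1)

theorem exists_gradient_le (hφ : ContDiff ℝ 1 φ) (hu : IsSolution φ u) (T : ℝ) :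
    ∃ M > 0, ∀ t ∈ Icc 0 T, ‖gradient φ (u t)‖ ≤ M := by
  obtain ⟨M, hM⟩ := isCompact_Icc.exists_bound_of_continuousOn
    ((hu.continuousOn_gradient hφ).mono fun _ (h : _ ∈ Icc 0 T) => h.1)
  exact ⟨max M 1, by positivity, fun t ht => (hM t ht).trans (le_max_left _ _)⟩

/-- Mean value inequality for `u t + t • c`. With `c` the gradient at the right endpoint it bounds
the residual of an Euler step; with `c = 0` it is a Lipschitz bound. -/
theorem norm_sub_add_smul_le (hu : IsSolution φ u) {a b η : ℝ} {c : H} (ha : 0 ≤ a) (hab : a ≤ b)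
    (h : ∀ r ∈ Icc a b, ‖gradient φ (u r) - c‖ ≤ η) :
    ‖u b - u a + (b - a) • c‖ ≤ η * (b - a) := by
  have := (convex_Icc a b).norm_image_sub_le_of_norm_hasDerivWithin_le
    (f := fun t => u t + t • c) (f' := fun t => -gradient φ (u t) + (1 : ℝ) • c) (C := η)
    (x := a) (y := b) (s := Icc a b)
    (fun t ht => ((hu.2 t (ha.trans ht.1)).mono fun s hs => ha.trans hs.1).add
      ((hasDerivWithinAt_id t _).smul_const c))
    (fun t ht => by
      rw [one_smul, neg_add_eq_sub, norm_sub_rev]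
      exact h t ht) (left_mem_Icc.2 hab) (right_mem_Icc.2 hab)
  rw [Real.norm_of_nonneg (sub_nonneg.2 hab)] at this
  convert this using 2
  rw [sub_smul]
  abel

theorem norm_sub_le (hu : IsSolution φ u) {a b M : ℝ} (ha : 0 ≤ a) (hab : a ≤ b)
    (h : ∀ r ∈ Icc a b, ‖gradient φ (u r)‖ ≤ M) : ‖u b - u a‖ ≤ M * (b - a) := by
  simpa using hu.norm_sub_add_smul_le (c := 0) ha hab (by simpa using h)

theorem norm_sub_le_abs (hu : IsSolution φ u) {a b T M : ℝ} (ha : a ∈ Icc 0 T) (hb : b ∈ Icc 0 T)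
    (h : ∀ r ∈ Icc 0 T, ‖gradient φ (u r)‖ ≤ M) : ‖u b - u a‖ ≤ M * |b - a| := by
  rcases le_total a b with hab | hab
  · rw [abs_of_nonneg (sub_nonneg.2 hab)]
    exact hu.norm_sub_le ha.1 hab fun r hr => h r ⟨ha.1.trans hr.1, hr.2.trans hb.2⟩
  · rw [abs_sub_comm, norm_sub_rev, abs_of_nonneg (sub_nonneg.2 hab)]
    exact hu.norm_sub_le hb.1 hab fun r hr => h r ⟨hb.1.trans hr.1, hr.2.trans ha.2⟩

theorem integrable_gradient_sq (hφ : ContDiff ℝ 1 φ) (hu : IsSolution φ u) {a b : ℝ} (ha : 0 ≤ a)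
    (hab : a ≤ b) : IntervalIntegrable (fun t => ‖gradient φ (u t)‖ ^ 2) volume a b := by
  refine ContinuousOn.intervalIntegrable_of_Icc hab ?_
  exact ((hu.continuousOn_gradient hφ).mono fun t ht => ha.trans ht.1).norm.pow 2

/-- Energy dissipation identity. -/
theorem integral_gradient_sq (hφ : ContDiff ℝ 1 φ) (hu : IsSolution φ u) {a b : ℝ} (ha : 0 ≤ a)
    (hab : a ≤ b) : ∫ t in a..b, ‖gradient φ (u t)‖ ^ 2 = φ (u a) - φ (u b) := by
  have h := intervalIntegral.integral_eq_sub_of_hasDeriv_right (a := a) (b := b)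
    (f := fun t => - φ (u t)) (f' := fun t => ‖gradient φ (u t)‖ ^ 2)
    (by
      rw [uIcc_of_le hab]
      exact (hφ.continuous.comp_continuousOn
        (hu.continuousOn.mono fun t ht => ha.trans ht.1)).neg)
    (fun t ht => by
      rw [min_eq_left hab, max_eq_right hab] at ht
      have ht0 : 0 ≤ t := ha.trans ht.1.le
      have h1 := ((hasGradientAt_gradient hφ (u t)).hasFDerivAt.comp_hasDerivWithinAt t
        ((hu.2 t ht0).mono (show Ioi t ⊆ Ici 0 from fun s hs => ht0.trans (le_of_lt hs)))).neg
      refine HasDerivWithinAt.congr_deriv (f := fun t => - φ (u t)) h1 ?_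
      rw [InnerProductSpace.toDual_apply_apply, inner_neg_right, neg_neg, real_inner_self_eq_norm_sq])
    (hu.integrable_gradient_sq hφ ha hab)
  rw [h]
  ring

theorem energy_anti (hφ : ContDiff ℝ 1 φ) (hu : IsSolution φ u) {a b : ℝ} (ha : 0 ≤ a)
    (hab : a ≤ b) : φ (u b) ≤ φ (u a) := by
  have h := hu.integral_gradient_sq hφ ha hab
  have := intervalIntegral.integral_nonneg (μ := volume) hab
    (f := fun t => ‖gradient φ (u t)‖ ^ 2) fun t _ => sq_nonneg _
  linarith

theorem gradient_eq_zero_of_energy_eq (hφ : ContDiff ℝ 1 φ) (hu : IsSolution φ u) {a b : ℝ}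
    (ha : 0 ≤ a) (hab : a < b) (h : φ (u a) ≤ φ (u b)) :
    ∀ t ∈ Icc a b, gradient φ (u t) = 0 := by
  intro t ht
  by_contra hne
  have hpos := intervalIntegral.integral_pos hab
    (f := fun t => ‖gradient φ (u t)‖ ^ 2)
    (((hu.continuousOn_gradient hφ).mono fun t ht => ha.trans ht.1).norm.pow 2)
    (fun t _ => sq_nonneg _) ⟨t, ht, by positivity⟩
  rw [hu.integral_gradient_sq hφ ha hab.le] at hpos
  linarith

theorem eq_of_energy_eq (hφ : ContDiff ℝ 1 φ) (hu : IsSolution φ u) {a b : ℝ}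
    (ha : 0 ≤ a) (hab : a ≤ b) (h : φ (u a) ≤ φ (u b)) : u b = u a := by
  rcases hab.eq_or_lt with rfl | hab'
  · rfl
  have := hu.norm_sub_le (M := 0) ha hab fun r hr => by
    rw [hu.gradient_eq_zero_of_energy_eq hφ ha hab' h r hr, norm_zero]
  rw [zero_mul] at this
  exact sub_eq_zero.1 (norm_le_zero_iff.1 this)

/-- Displacement is controlled by dissipation, by the Cauchy-Schwarz inequality. -/
theorem norm_sub_sq_le (hφ : ContDiff ℝ 1 φ) (hu : IsSolution φ u) {a b : ℝ} (ha : 0 ≤ a)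
    (hab : a ≤ b) : ‖u b - u a‖ ^ 2 ≤ (b - a) * (φ (u a) - φ (u b)) := by
  set e := u b - u a with he
  have h := intervalIntegral.integral_eq_sub_of_hasDeriv_right (a := a) (b := b)
    (f := fun t => inner ℝ e (u t)) (f' := fun t => inner ℝ e (-gradient φ (u t)))
    (by
      rw [uIcc_of_le hab]
      exact continuousOn_const.inner (𝕜 := ℝ) (hu.continuousOn.mono fun t ht => ha.trans ht.1))
    (fun t ht => by
      rw [min_eq_left hab, max_eq_right hab] at ht
      have ht0 : 0 ≤ t := ha.trans ht.1.le
      have h1 := (innerSL ℝ e).hasFDerivAt.comp_hasDerivWithinAt t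
        ((hu.2 t ht0).mono (show Ioi t ⊆ Ici 0 from fun s hs => ht0.trans (le_of_lt hs)))
      exact h1)
    (ContinuousOn.intervalIntegrable_of_Icc hab (continuousOn_const.inner (𝕜 := ℝ)
      ((hu.continuousOn_gradient hφ).mono fun t ht => ha.trans ht.1).neg))
  rw [← inner_sub_right, ← he, real_inner_self_eq_norm_sq] at h
  have hi := hu.integrable_gradient_sq hφ ha hab
  -- Young's inequality, weighted so that after integration half of `(b - a) * ‖e‖ ^ 2` is absorbed
  -- on the left.
  have h2 := intervalIntegral.integral_mono_on (μ := volume) hab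
    (f := fun t => (b - a) * inner ℝ e (-gradient φ (u t)))
    (g := fun t => (b - a) ^ 2 / 2 * ‖gradient φ (u t)‖ ^ 2 + ‖e‖ ^ 2 / 2)
    ((ContinuousOn.intervalIntegrable_of_Icc hab (continuousOn_const.inner (𝕜 := ℝ)
      ((hu.continuousOn_gradient hφ).mono fun t ht => ha.trans ht.1).neg)).const_mul _)
    ((hi.const_mul _).add intervalIntegrable_const)
    (fun t _ => by
      have h3 := real_inner_le_norm e (-gradient φ (u t))
      rw [norm_neg] at h3
      nlinarith [mul_le_mul_of_nonneg_left h3 (sub_nonneg.2 hab),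
        sq_nonneg ((b - a) * ‖gradient φ (u t)‖ - ‖e‖)])
  rw [intervalIntegral.integral_const_mul, h, intervalIntegral.integral_add (hi.const_mul _)
    intervalIntegrable_const, intervalIntegral.integral_const_mul,
    hu.integral_gradient_sq hφ ha hab, intervalIntegral.integral_const, smul_eq_mul] at h2
  rcases hab.eq_or_lt with rfl | hab'
  · simp [he]
  · have : 0 < b - a := sub_pos.2 hab'
    nlinarith

end IsSolution

end GradientFlow

section CriticalTimes

variable {H : Type*} [NormedAddCommGroup H] [InnerProductSpace ℝ H] [CompleteSpace H]
  {φ : H → ℝ} {u : ℝ → H}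

/-! ### Minimal solutions spend no time at critical points before becoming stationary -/

/-- The critical times of `u` in `[0, L]`. -/
def criticalTimes (φ : H → ℝ) (u : ℝ → H) (L : ℝ) : Set ℝ :=
  {t | t ∈ Icc 0 L ∧ gradient φ (u t) = 0}

/-- The time elapsed until `t` when the clock stops at the critical times in `[0, L]`. -/
noncomputable def collapsedTime (φ : H → ℝ) (u : ℝ → H) (L t : ℝ) : ℝ :=
  ∫ s in 0..t, (criticalTimes φ u L)ᶜ.indicator (fun _ => (1 : ℝ)) s

namespace IsSolution

theorem measurableSet_criticalTimes (hφ : ContDiff ℝ 1 φ) (hu : IsSolution φ u) (L : ℝ) :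
    MeasurableSet (criticalTimes φ u L) := by
  have h : ContinuousOn (fun t => gradient φ (u t)) (Icc 0 L) :=
    (hu.continuousOn_gradient hφ).mono fun t ht => ht.1
  exact (h.preimage_isClosed_of_isClosed isClosed_Icc (isClosed_singleton (x := 0))).measurableSet

theorem integrable_indicator_criticalTimes (hφ : ContDiff ℝ 1 φ) (hu : IsSolution φ u)
    (L a b : ℝ) :
    IntervalIntegrable ((criticalTimes φ u L)ᶜ.indicator (fun _ => (1 : ℝ))) volume a b := by
  rw [intervalIntegrable_iff]
  exact (integrableOn_const (by simp)).indicator (hu.measurableSet_criticalTimes hφ L).compl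

theorem collapsedTime_sub (hφ : ContDiff ℝ 1 φ) (hu : IsSolution φ u) (L a b : ℝ) :
    collapsedTime φ u L b - collapsedTime φ u L a =
      ∫ s in a..b, (criticalTimes φ u L)ᶜ.indicator (fun _ => (1 : ℝ)) s :=
  intervalIntegral.integral_interval_sub_left (hu.integrable_indicator_criticalTimes hφ L _ _)
    (hu.integrable_indicator_criticalTimes hφ L _ _)

theorem collapsedTime_mono (hφ : ContDiff ℝ 1 φ) (hu : IsSolution φ u) (L : ℝ) {a b : ℝ}
    (hab : a ≤ b) : 0 ≤ collapsedTime φ u L b - collapsedTime φ u L a := by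
  rw [hu.collapsedTime_sub hφ]
  exact intervalIntegral.integral_nonneg hab fun t _ => indicator_nonneg (fun _ _ => zero_le_one) t

theorem collapsedTime_sub_le (hφ : ContDiff ℝ 1 φ) (hu : IsSolution φ u) (L : ℝ) {a b : ℝ}
    (hab : a ≤ b) : collapsedTime φ u L b - collapsedTime φ u L a ≤ b - a := by
  rw [hu.collapsedTime_sub hφ]
  have := intervalIntegral.integral_mono_on (μ := volume) hab
    (hu.integrable_indicator_criticalTimes hφ L a b)
    (intervalIntegrable_const (c := (1 : ℝ))) fun t _ =>
      indicator_le_self' (fun _ _ => zero_le_one) t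
  simpa using this

theorem continuous_collapsedTime (hφ : ContDiff ℝ 1 φ) (hu : IsSolution φ u) (L : ℝ) :
    Continuous (collapsedTime φ u L) :=
  intervalIntegral.continuous_primitive (hu.integrable_indicator_criticalTimes hφ L) 0

theorem collapsedTime_eq (hφ : ContDiff ℝ 1 φ) (hu : IsSolution φ u) {L t : ℝ} (hL : 0 ≤ L)
    (ht : L ≤ t) :
    collapsedTime φ u L t = t - volume.real (criticalTimes φ u L) := by
  have hm := hu.measurableSet_criticalTimes hφ L
  have hsub : criticalTimes φ u L ⊆ Icc 0 t := fun s hs => ⟨hs.1.1, hs.1.2.trans ht⟩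
  rw [collapsedTime, intervalIntegral.integral_of_le (hL.trans ht), ← integral_Icc_eq_integral_Ioc,
    integral_indicator_const _ hm.compl, measureReal_restrict_apply hm.compl, inter_comm,
    ← sdiff_eq, measureReal_sdiff hsub hm measure_Icc_lt_top.ne]
  simp [hL.trans ht]

/-- At a critical time neither `u` nor the stopped clock moves, so the integrand vanishes there,
whatever `c` is. At all other times the clock runs at unit speed. -/
theorem norm_sub_add_collapsedTime_smul_le (hφ : ContDiff ℝ 1 φ) (hu : IsSolution φ u) (L : ℝ)
    {a b η : ℝ} {c : H} (ha : 0 ≤ a) (hab : a ≤ b) (h : ∀ r ∈ Icc a b, ‖gradient φ (u r) - c‖ ≤ η) :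
    ‖u b - u a + (collapsedTime φ u L b - collapsedTime φ u L a) • c‖ ≤
      η * (collapsedTime φ u L b - collapsedTime φ u L a) := by
  set f := (criticalTimes φ u L)ᶜ.indicator (fun _ => (1 : ℝ)) with hf
  have hfi : IntervalIntegrable f volume a b := hu.integrable_indicator_criticalTimes hφ L a b
  have hgi : IntervalIntegrable (fun t => -gradient φ (u t)) volume a b :=
    ContinuousOn.intervalIntegrable_of_Icc hab
      ((hu.continuousOn_gradient hφ).mono fun t ht => ha.trans ht.1).neg
  have h1 : ∫ t in a..b, -gradient φ (u t) = u b - u a :=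
    intervalIntegral.integral_eq_sub_of_hasDeriv_right
      (by rw [uIcc_of_le hab]; exact hu.continuousOn.mono fun t ht => ha.trans ht.1)
      (fun t ht => by
        rw [min_eq_left hab] at ht
        have ht0 : 0 ≤ t := ha.trans ht.1.le
        exact (hu.2 t ht0).mono fun s hs => ht0.trans (le_of_lt hs)) hgi
  have hfc : ∫ t in a..b, f t • c = (∫ t in a..b, f t) • c :=
    intervalIntegral.integral_smul_const f c
  rw [hu.collapsedTime_sub hφ, ← h1, ← hfc, ← intervalIntegral.integral_add hgi
    (show IntervalIntegrable (fun t => f t • c) volume a b from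
      ⟨Integrable.smul_const hfi.1 c, Integrable.smul_const hfi.2 c⟩),
    ← intervalIntegral.integral_const_mul]
  refine intervalIntegral.norm_integral_le_of_norm_le hab (ae_of_all _ fun t ht => ?_)
    (hfi.const_mul _)
  have ht' : t ∈ Icc a b := ⟨ht.1.le, ht.2⟩
  by_cases hc : t ∈ criticalTimes φ u L
  · rw [hf, indicator_of_notMem (by simpa using hc), hc.2]
    simp
  · rw [hf, indicator_of_mem (by simpa using hc), one_smul, mul_one, neg_add_eq_sub, norm_sub_rev]
    exact h t ht'

end IsSolution

/-- A time change which collapses the critical times in `[0, L]` turns a solution into a solution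
that it succeeds. -/
theorem IsSolution.exists_collapse (hφ : ContDiff ℝ 1 φ) (hu : IsSolution φ u) {L : ℝ}
    (hL : 0 ≤ L) :
    ∃ v : ℝ → H, IsSolution φ v ∧ Succeeds u v ∧
      ∀ t, 0 ≤ t → u t = v (collapsedTime φ u L t) := by
  set z := collapsedTime φ u L with hz
  have hz0 : z 0 = 0 := by simp [hz, collapsedTime]
  have hmono : ∀ {a b}, a ≤ b → 0 ≤ z b - z a := hu.collapsedTime_mono hφ L
  have hznn : ∀ {t}, 0 ≤ t → 0 ≤ z t := fun {t} ht => by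
    have := hmono ht
    rwa [hz0, sub_zero] at this
  have hlarge : ∀ {t}, L ≤ t → z t = t - volume.real (criticalTimes φ u L) :=
    hu.collapsedTime_eq hφ hL
  have hmes : volume.real (criticalTimes φ u L) ≤ L := by
    have := hznn hL
    rw [hlarge le_rfl] at this
    linarith
  -- The clock stops only inside `[0, L]` and afterwards runs at unit speed, so it reaches every
  -- nonnegative time. Cutting at `L` ensures this.
  have hsurj : ∀ r, 0 ≤ r → ∃ t, 0 ≤ t ∧ z t = r := fun r hr => by
    have := intermediate_value_Icc (add_nonneg hr hL)
      (hu.continuous_collapsedTime hφ L).continuousOn (f := z)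
    obtain ⟨t, ht, htr⟩ := this (show r ∈ Icc (z 0) (z (r + L)) from
      ⟨hz0.trans_le hr, by rw [hlarge (by linarith)]; linarith⟩)
    exact ⟨t, ht.1, htr⟩
  choose! σ hσ0 hσ using hsurj
  -- With `c = 0` this shows that `u t` depends only on `z t`; with `c` a gradient it gives the
  -- differential equation for the collapsed curve.
  have key : ∀ {a b η : ℝ} {c : H}, 0 ≤ a → a ≤ b →
      (∀ r ∈ Icc a b, ‖gradient φ (u r) - c‖ ≤ η) →
      ‖u b - u a + (z b - z a) • c‖ ≤ η * (z b - z a) :=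
    hu.norm_sub_add_collapsedTime_smul_le hφ L
  have hcongr' : ∀ {a b}, 0 ≤ a → a ≤ b → z a = z b → u a = u b := fun {a b} ha hab h => by
    obtain ⟨M, -, hM⟩ := hu.exists_gradient_le hφ b
    have := key (c := 0) (η := M) ha hab fun r hr => by
      rw [sub_zero]; exact hM r ⟨ha.trans hr.1, hr.2⟩
    rw [h] at this
    simp only [sub_self, smul_zero, add_zero, mul_zero] at this
    exact (sub_eq_zero.1 (norm_le_zero_iff.1 this)).symm
  have hcongr : ∀ {a b}, 0 ≤ a → 0 ≤ b → z a = z b → u a = u b := fun {a b} ha hb h => by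
    rcases le_total a b with hab | hab
    · exact hcongr' ha hab h
    · exact (hcongr' hb hab h.symm).symm
  have huv : ∀ t, 0 ≤ t → u t = u (σ (z t)) := fun t ht =>
    hcongr ht (hσ0 _ (hznn ht)) (hσ _ (hznn ht)).symm
  set v : ℝ → H := fun r => u (σ r) with hv
  have hσmono : ∀ {r s}, 0 ≤ r → 0 ≤ s → r < s → σ r ≤ σ s := fun {r s} hr hs hrs => by
    by_contra! hcon
    have := hmono hcon.le
    rw [hσ _ hr, hσ _ hs] at this
    linarith
  have keyv : ∀ {r s η : ℝ} {c : H}, 0 ≤ r → r ≤ s →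
      (∀ q ∈ Icc r s, ‖gradient φ (v q) - c‖ ≤ η) →
      ‖v s - v r + (s - r) • c‖ ≤ η * (s - r) := fun {r s η c} hr hrs h => by
    rcases hrs.eq_or_lt with rfl | hlt
    · simp
    have hs := hr.trans hrs
    have := key (c := c) (η := η) (hσ0 r hr) (hσmono hr hs hlt) fun q hq => by
      have hq0 : 0 ≤ q := (hσ0 r hr).trans hq.1
      have h1 := hmono hq.1
      have h2 := hmono hq.2
      rw [hσ _ hr] at h1
      rw [hσ _ hs] at h2
      rw [huv q hq0]
      exact h (z q) ⟨by linarith, by linarith⟩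
    rwa [hσ _ hr, hσ _ hs] at this
  have hvcont : ContinuousOn v (Ici 0) := by
    intro r hr
    have hr : 0 ≤ r := hr
    obtain ⟨M, -, hM⟩ := hu.exists_gradient_le hφ (σ (r + 1))
    have hMv : ∀ q ∈ Ico 0 (r + 1), ‖gradient φ (v q)‖ ≤ M := fun q hq =>
      hM _ ⟨hσ0 q hq.1, hσmono hq.1 (by linarith) hq.2⟩
    have hlip : ∀ s ∈ Ico 0 (r + 1), ‖v s - v r‖ ≤ M * |s - r| := fun s hs => by
      rcases le_total r s with hrs | hrs
      · have := keyv (c := 0) (η := M) hr hrs fun q hq => by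
          rw [sub_zero]; exact hMv q ⟨hr.trans hq.1, hq.2.trans_lt hs.2⟩
        rw [abs_of_nonneg (sub_nonneg.2 hrs)]
        simpa using this
      · have := keyv (c := 0) (η := M) hs.1 hrs fun q hq => by
          rw [sub_zero]; exact hMv q ⟨hs.1.trans hq.1, by linarith [hq.2]⟩
        rw [abs_sub_comm, norm_sub_rev, abs_of_nonneg (sub_nonneg.2 hrs)]
        simpa using this
    rw [ContinuousWithinAt, tendsto_iff_norm_sub_tendsto_zero]
    refine squeeze_zero' (Eventually.of_forall fun _ => norm_nonneg _)
      (g := fun s => M * |s - r|) ?_ ?_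
    · filter_upwards [self_mem_nhdsWithin,
        mem_nhdsWithin_of_mem_nhds (Iio_mem_nhds (lt_add_one r))] with s hs0 hs1
      exact hlip s ⟨hs0, hs1⟩
    · have : Continuous fun s => M * |s - r| := by fun_prop
      have h2 := this.tendsto r
      simp only [sub_self, abs_zero, mul_zero] at h2
      exact h2.mono_left nhdsWithin_le_nhds
  have hgcont : ContinuousOn (fun r => gradient φ (v r)) (Ici 0) :=
    (continuous_gradient hφ).comp_continuousOn hvcont
  have hderiv : ∀ r, 0 ≤ r → HasDerivWithinAt v (-gradient φ (v r)) (Ici 0) r := fun r hr => by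
    rw [hasDerivWithinAt_iff_isLittleO, Asymptotics.isLittleO_iff]
    intro η hη
    obtain ⟨δ, hδ, hd⟩ := Metric.continuousWithinAt_iff.1 (hgcont r hr) η hη
    have hd' : ∀ q, 0 ≤ q → |q - r| < δ → ‖gradient φ (v q) - gradient φ (v r)‖ ≤ η :=
      fun q hq hqr => by
        rw [← dist_eq_norm]
        exact (hd hq (by rwa [Real.dist_eq])).le
    filter_upwards [self_mem_nhdsWithin, mem_nhdsWithin_of_mem_nhds (Metric.ball_mem_nhds r hδ)]
      with s hs0 hs1
    have hs0 : 0 ≤ s := hs0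
    rw [Metric.mem_ball, Real.dist_eq] at hs1
    rw [smul_neg, sub_neg_eq_add, Real.norm_eq_abs]
    rcases le_total r s with hrs | hrs
    · rw [abs_of_nonneg (sub_nonneg.2 hrs)] at hs1 ⊢
      exact keyv hr hrs fun q hq => hd' q (hr.trans hq.1)
        (by rw [abs_of_nonneg (sub_nonneg.2 hq.1)]; linarith [hq.2])
    · rw [abs_sub_comm, abs_of_nonneg (sub_nonneg.2 hrs)] at hs1 ⊢
      have := keyv (c := gradient φ (v r)) (η := η) hs0 hrs fun q hq => hd' q (hs0.trans hq.1)
        (by rw [abs_sub_comm, abs_of_nonneg (sub_nonneg.2 hq.2)]; linarith [hq.1])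
      rw [← norm_neg] at this
      refine (congrArg norm ?_).trans_le this
      rw [sub_smul, sub_smul]
      abel
  refine ⟨v, ⟨?_, hderiv⟩, ⟨?_, z, hz0, fun s t _ hst =>
    ⟨hmono hst, hu.collapsedTime_sub_le hφ L hst⟩, huv⟩, huv⟩
  · rw [contDiffOn_one_iff_derivWithin (uniqueDiffOn_Ici 0)]
    refine ⟨fun r hr => (hderiv r hr).differentiableWithinAt, hgcont.neg.congr fun r hr => ?_⟩
    exact (hderiv r hr).derivWithin (uniqueDiffOn_Ici 0 r hr)
  · rintro _ ⟨r, hr, rfl⟩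
    exact subset_closure ⟨σ r, hσ0 r hr, rfl⟩

/-- A minimal solution has almost no critical times before the time when it becomes stationary. -/
theorem IsMinimalSolution.ae_gradient_ne_zero (hφ : ContDiff ℝ 1 φ) (hu : IsMinimalSolution φ u)
    {L : ℝ} (hL : 0 ≤ L) (hne : ∃ t, L ≤ t ∧ u t ≠ u L) :
    volume (criticalTimes φ u L) = 0 := by
  obtain ⟨v, hv, huv, hz⟩ := hu.1.exists_collapse hφ hL
  have heq := hu.2 v hv huv
  set m := volume.real (criticalTimes φ u L) with hm
  have hfin : volume (criticalTimes φ u L) ≠ ⊤ :=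
    ((measure_mono fun t ht => ht.1).trans_lt (measure_Icc_lt_top (a := (0 : ℝ)) (b := L))).ne
  by_contra hpos
  have hmpos : 0 < m := ENNReal.toReal_pos hpos hfin
  have hmL : m ≤ L := by
    have := measureReal_mono (μ := volume) (s₁ := criticalTimes φ u L) (s₂ := Icc 0 L)
      (fun t ht => ht.1) (by simp)
    simpa [hL] using this
  -- Minimality identifies the collapsed curve with `u`, so `u` has period `m` from then on.
  -- Decreasing energy makes a periodic solution stationary.
  have hper : ∀ t, L ≤ t → u t = u (t - m) := fun t ht => by
    have h1 := hz t (hL.trans ht)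
    rw [hu.1.collapsedTime_eq hφ hL ht] at h1
    rw [h1]
    exact (heq (show 0 ≤ t - m by linarith)).symm
  obtain ⟨t, ht, htne⟩ := hne
  have hn : ∀ n : ℕ, u (L + n * m) = u L := fun n => by
    induction n with
    | zero => simp
    | succ n ih =>
      rw [hper _ (by have : 0 ≤ ((n + 1 : ℕ) : ℝ) * m := by positivity
                     linarith), ← ih]
      congr 1
      push_cast
      ring
  obtain ⟨n, hn'⟩ := exists_nat_gt ((t - L) / m)
  rw [div_lt_iff₀ hmpos] at hn'
  refine htne (hu.1.eq_of_energy_eq hφ hL ht ?_)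
  rw [← hn n]
  exact hu.1.energy_anti hφ (hL.trans ht) (by linarith)

end CriticalTimes

section PenalizedStep

/-! ### One step of the penalized scheme -/

theorem sampledRange_finite {H : Type*} (u : ℝ → H) (τ S : ℝ) : (sampledRange u τ S).Finite := by
  refine ((finite_Iic (numSteps τ S)).image fun n : ℕ => u (n * τ)).subset ?_
  rintro x ⟨n, hn, rfl⟩
  exact ⟨n, hn, rfl⟩

variable {H : Type*} [NormedAddCommGroup H]

/-- The functional which is minimized in one step of the scheme. -/
noncomputable def stepFun (τ : ℝ) (ψ : H → ℝ) (x V : H) : ℝ :=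
  1 / (2 * τ) * ‖V - x‖ ^ 2 + ψ V

/-- `V` is a possible successor of `x` in the scheme. -/
def IsStep (τ : ℝ) (ψ : H → ℝ) (x V : H) : Prop :=
  ∀ W : H, stepFun τ ψ x V ≤ stepFun τ ψ x W

theorem stepFun_add_mul (τ : ℝ) (φ : H → ℝ) (d : H → ℝ) (c : ℝ) (x V : H) :
    stepFun τ (fun x => φ x + c * d x) x V = stepFun τ φ x V + c * d V := by
  simp only [stepFun]
  ring

theorem eq_of_stepFun_le {φ : H → ℝ} {x V : H} {τ : ℝ} (hτ : 0 < τ) (h1 : φ x ≤ φ V)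
    (h2 : stepFun τ φ x V ≤ φ x) : V = x := by
  rw [stepFun] at h2
  have h3 : 1 / (2 * τ) * ‖V - x‖ ^ 2 ≤ 0 := by linarith
  have h4 : ‖V - x‖ ^ 2 ≤ 0 := nonpos_of_mul_nonpos_right h3 (by positivity)
  exact sub_eq_zero.1 (norm_eq_zero.1 (pow_eq_zero_iff two_ne_zero |>.1
    (le_antisymm h4 (sq_nonneg _))))

/-- A functional with the quadratic lower bound is large away from `x` for small time steps. -/
theorem QuadraticLowerBound.eventually_stepFun_lt {φ : H → ℝ} (hlow : QuadraticLowerBound φ)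
    (hφ : Continuous φ) {K : Set H} (hK : IsCompact K) {δ : ℝ} (hδ : 0 < δ) (M : ℝ) :
    ∀ᶠ τ in 𝓝[>] (0 : ℝ), ∀ x ∈ K, ∀ y ∈ K, ‖y - x‖ ≤ M * τ → ∀ V : H, δ < ‖V - y‖ →
      stepFun τ φ x y < stepFun τ φ x V := by
  obtain ⟨τs, hτs, φs, hlow⟩ := hlow
  obtain ⟨ρ, hρ⟩ := hK.isBounded.exists_norm_le
  obtain ⟨Φ, hΦ⟩ := hK.exists_bound_of_continuousOn hφ.continuousOn
  set C := M ^ 2 + Φ + ρ ^ 2 / τs + φs with hC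
  have hlim : Tendsto (fun τ : ℝ => τ * (C + δ ^ 2 / (4 * τs))) (𝓝[>] 0) (𝓝 0) := by
    have : Continuous fun τ : ℝ => τ * (C + δ ^ 2 / (4 * τs)) := by fun_prop
    have h := this.tendsto 0
    rw [zero_mul] at h
    exact h.mono_left nhdsWithin_le_nhds
  have hlim2 : Tendsto (fun τ : ℝ => M * τ) (𝓝[>] 0) (𝓝 0) := by
    have : Continuous fun τ : ℝ => M * τ := by fun_prop
    have h := this.tendsto 0
    rw [mul_zero] at h
    exact h.mono_left nhdsWithin_le_nhds
  filter_upwards [self_mem_nhdsWithin, hlim.eventually_lt_const (by positivity : 0 < δ ^ 2 / 8),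
    hlim2.eventually_lt_const (half_pos hδ),
    (mem_nhdsWithin_of_mem_nhds (Iio_mem_nhds (half_pos hτs)) : Iio (τs / 2) ∈ 𝓝[>] (0 : ℝ)),
    (mem_nhdsWithin_of_mem_nhds (Iio_mem_nhds one_pos) : Iio 1 ∈ 𝓝[>] (0 : ℝ))]
    with τ hτ h1 h2 h3 h4 x hx y hy hxy V hV
  have hτ : 0 < τ := hτ
  have h3 : τ < τs / 2 := h3
  have h4 : τ < 1 := h4
  have hVx : δ / 2 ≤ ‖V - x‖ := by
    have : V - y = (V - x) - (y - x) := by abel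
    have h5 := norm_sub_le (V - x) (y - x)
    rw [← this] at h5
    linarith
  have hV2 : ‖V‖ ^ 2 ≤ 2 * ‖V - x‖ ^ 2 + 2 * ‖x‖ ^ 2 := by
    have h5 := norm_add_le (V - x) x
    rw [sub_add_cancel] at h5
    nlinarith [sq_nonneg (‖V - x‖ - ‖x‖), norm_nonneg V]
  have hxρ : ‖x‖ ^ 2 ≤ ρ ^ 2 := pow_le_pow_left₀ (norm_nonneg _) (hρ x hx) 2
  have hyx : ‖y - x‖ ^ 2 ≤ (M * τ) ^ 2 := pow_le_pow_left₀ (norm_nonneg _) hxy 2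
  have hVx2 : (δ / 2) ^ 2 ≤ ‖V - x‖ ^ 2 := pow_le_pow_left₀ (by positivity) hVx 2
  have hF1 : stepFun τ φ x y ≤ M ^ 2 + Φ := by
    have h5 : 1 / (2 * τ) * ‖y - x‖ ^ 2 ≤ 1 / (2 * τ) * (M * τ) ^ 2 := by gcongr
    have h6 : 1 / (2 * τ) * (M * τ) ^ 2 = M ^ 2 * (τ / 2) := by field_simp
    have h7 : M ^ 2 * (τ / 2) ≤ M ^ 2 := mul_le_of_le_one_right (sq_nonneg _) (by linarith)
    have h8 := (abs_le.1 (hΦ y hy)).2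
    rw [stepFun]
    linarith
  have hF2 : (1 / (2 * τ) - 1 / τs) * ‖V - x‖ ^ 2 - ρ ^ 2 / τs - φs ≤ stepFun τ φ x V := by
    have h5 : 1 / (2 * τs) * ‖V‖ ^ 2 ≤ 1 / (2 * τs) * (2 * ‖V - x‖ ^ 2 + 2 * ρ ^ 2) := by
      gcongr
      linarith
    have h6 : 1 / (2 * τs) * (2 * ‖V - x‖ ^ 2 + 2 * ρ ^ 2) = 1 / τs * ‖V - x‖ ^ 2 + ρ ^ 2 / τs := by
      field_simp
    have h7 := hlow V
    rw [stepFun]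
    linarith
  have hcoef : 0 ≤ 1 / (2 * τ) - 1 / τs := by
    rw [sub_nonneg]
    exact one_div_le_one_div_of_le (by positivity) (by linarith)
  have h5 := mul_le_mul_of_nonneg_left hVx2 hcoef
  have h6 : C < (1 / (2 * τ) - 1 / τs) * (δ / 2) ^ 2 := by
    -- Multiplied by `τ`, the quadratic gain away from `x` tends to `δ ^ 2 / 8`, while `τ * C` tends
    -- to `0`.
    have h7 : τ * C < τ * ((1 / (2 * τ) - 1 / τs) * (δ / 2) ^ 2) := by
      have : τ * ((1 / (2 * τ) - 1 / τs) * (δ / 2) ^ 2) = δ ^ 2 / 8 - τ * (δ ^ 2 / (4 * τs)) := by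
        field_simp
        ring
      rw [this]
      linarith
    exact lt_of_mul_lt_mul_left h7 hτ.le
  linarith

variable [InnerProductSpace ℝ H] [CompleteSpace H] {φ : H → ℝ}

/-- The derivative of the step functional at `p` is the Euler residual divided by `τ`, of norm at
most `r`; the Taylor error of `φ` costs another `ε`, and the quadratic term is kept exactly. -/
theorem stepFun_lower_bound (hφ : ContDiff ℝ 1 φ) {p : H} {δ ε τ : ℝ} (hτ : 0 < τ)
    (h : ∀ x : H, ‖x - p‖ ≤ δ → ‖gradient φ x - gradient φ p‖ ≤ ε) (x : H) {V : H}
    (hV : ‖V - p‖ ≤ δ) {r : ℝ} (hr : ‖p - x + τ • gradient φ p‖ ≤ r * τ) :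
    stepFun τ φ x p - (r + ε) * ‖V - p‖ + 1 / (2 * τ) * ‖V - p‖ ^ 2 ≤ stepFun τ φ x V := by
  have h1 := (abs_le.1 (abs_sub_inner_gradient_le hφ h hV)).1
  have h2 : ‖V - x‖ ^ 2 = ‖V - p‖ ^ 2 + 2 * inner ℝ (p - x) (V - p) + ‖p - x‖ ^ 2 := by
    rw [show V - x = (V - p) + (p - x) by abel, norm_add_sq_real, real_inner_comm]
  have h3 := neg_le_of_abs_le (abs_real_inner_le_norm (p - x + τ • gradient φ p) (V - p))
  rw [inner_add_left, real_inner_smul_left] at h3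
  have h4 := mul_le_mul_of_nonneg_right hr (norm_nonneg (V - p))
  have h5 : 1 / (2 * τ) * ‖V - x‖ ^ 2 = 1 / (2 * τ) * ‖V - p‖ ^ 2 +
      1 / τ * inner ℝ (p - x) (V - p) + 1 / (2 * τ) * ‖p - x‖ ^ 2 := by
    rw [h2]
    field_simp
  have h6 : -(r * ‖V - p‖) ≤ 1 / τ * inner ℝ (p - x) (V - p) + inner ℝ (gradient φ p) (V - p) := by
    have h7 : τ * -(r * ‖V - p‖) ≤
        τ * (1 / τ * inner ℝ (p - x) (V - p) + inner ℝ (gradient φ p) (V - p)) := by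
      rw [mul_add, ← mul_assoc, mul_one_div_cancel hτ.ne', one_mul]
      linarith
    exact le_of_mul_le_mul_left h7 hτ
  rw [stepFun, stepFun]
  linarith

/-- If `y ∈ R` almost satisfies the Euler equation of the step starting from `x`, then a
distance penalization confines the minimizers to `R`, close to `y`. -/
theorem exists_isStep_and_forall_mem (hφ : ContDiff ℝ 1 φ) {R : Set H} (hR : IsCompact R)
    {δ ε τ : ℝ} (hτ : 0 < τ) (hε : 0 < ε)
    (hosc : ∀ p ∈ R, ∀ x : H, ‖x - p‖ ≤ δ → ‖gradient φ x - gradient φ p‖ ≤ ε)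
    (hδ : 8 * ε * τ ≤ δ) {x y : H} (hy : y ∈ R) (hxy : ‖y - x + τ • gradient φ y‖ ≤ ε * τ)
    (hfar : ∀ V : H, δ < ‖V - y‖ → stepFun τ φ x y < stepFun τ φ x V) :
    (∃ V, IsStep τ (fun z => φ z + 12 * ε * Metric.infDist z R) x V) ∧
    ∀ V, IsStep τ (fun z => φ z + 12 * ε * Metric.infDist z R) x V →
      V ∈ R ∧ ‖V - y‖ ≤ 4 * ε * τ ∧ stepFun τ φ x V ≤ stepFun τ φ x y := by
  have key : ∀ V, stepFun τ φ x V + 12 * ε * Metric.infDist V R ≤ stepFun τ φ x y →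
      ‖V - y‖ ≤ 4 * ε * τ ∧ ∃ p ∈ R, stepFun τ φ x p + ε * ‖V - p‖ ≤
        stepFun τ φ x V + 12 * ε * Metric.infDist V R := by
    intro V hV
    have hd : 0 ≤ 12 * ε * Metric.infDist V R := mul_nonneg (by positivity) Metric.infDist_nonneg
    have hVδ : ‖V - y‖ ≤ δ := by
      by_contra! hcon
      linarith [hfar V hcon]
    have hVy : ‖V - y‖ ≤ 4 * ε * τ := by
      -- At `y` the linear loss is `ε + ε` per unit distance; balanced against the quadratic term it
      -- gives the radius `4 * ε * τ`.
      have h1 := stepFun_lower_bound hφ hτ (hosc y hy) x hVδ hxy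
      have h2 : 1 / (2 * τ) * ‖V - y‖ ^ 2 ≤ 2 * ε * ‖V - y‖ := by linarith
      rw [one_div, inv_mul_le_iff₀ (by positivity)] at h2
      by_contra! hcon
      have h3 : 0 < ‖V - y‖ := lt_trans (by positivity) hcon
      nlinarith
    obtain ⟨p, hp, hpd⟩ := hR.exists_infDist_eq_dist ⟨y, hy⟩ V
    have hpV : ‖V - p‖ ≤ ‖V - y‖ := by
      rw [← dist_eq_norm, ← dist_eq_norm, ← hpd]
      exact Metric.infDist_le_dist_of_mem hy
    have hpy : ‖p - y‖ ≤ 8 * ε * τ := by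
      have := norm_sub_le (V - y) (V - p)
      rw [show V - y - (V - p) = p - y by abel] at this
      linarith
    have hp' : ‖p - x + τ • gradient φ p‖ ≤ 10 * ε * τ := by
      have e : p - x + τ • gradient φ p =
          (y - x + τ • gradient φ y) + (p - y) + τ • (gradient φ p - gradient φ y) := by
        rw [smul_sub]
        abel
      rw [e]
      refine (norm_add₃_le).trans ?_
      rw [norm_smul, Real.norm_of_nonneg hτ.le]
      have := mul_le_mul_of_nonneg_left (hosc y hy p (hpy.trans hδ)) hτ.le
      linarith
    -- The nearest sample `p` has residual `(1 + 8 + 1) * ε * τ`, so the linear loss is `11 * ε`.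
    -- Slope `12 * ε` leaves a surplus `ε`, which forces a minimizer to coincide with `p`.
    have h1 := stepFun_lower_bound hφ hτ (hosc p hp) x (hpV.trans hVδ) hp'
    refine ⟨hVy, p, hp, ?_⟩
    rw [hpd, dist_eq_norm]
    have : 0 ≤ 1 / (2 * τ) * ‖V - p‖ ^ 2 := by positivity
    linarith
  have hmin0 : ∀ V ∈ R, Metric.infDist V R = 0 := fun V hV => Metric.infDist_zero_of_mem hV
  constructor
  · have hcont : Continuous (stepFun τ φ x) := by
      have := hφ.continuous
      unfold stepFun
      fun_prop
    obtain ⟨q, hq, hqmin⟩ := hR.exists_isMinOn ⟨y, hy⟩ hcont.continuousOn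
    refine ⟨q, fun W => ?_⟩
    rw [stepFun_add_mul, stepFun_add_mul, hmin0 q hq, mul_zero, add_zero]
    rcases le_or_gt (stepFun τ φ x W + 12 * ε * Metric.infDist W R) (stepFun τ φ x y) with h | h
    · obtain ⟨-, p, hp, hpW⟩ := key W h
      have h1 := isMinOn_iff.1 hqmin p hp
      have h2 : 0 ≤ ε * ‖W - p‖ := by positivity
      linarith
    · exact (isMinOn_iff.1 hqmin y hy).trans h.le
  · intro V hV
    have hVW := fun W => hV W
    simp only [stepFun_add_mul] at hVW
    have h1 := hVW y
    rw [hmin0 y hy, mul_zero, add_zero] at h1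
    obtain ⟨hVy, p, hp, hpV⟩ := key V h1
    have h2 := hVW p
    rw [hmin0 p hp, mul_zero, add_zero] at h2
    have h3 : ‖V - p‖ ≤ 0 := by nlinarith
    have h4 : V = p := sub_eq_zero.1 (norm_le_zero_iff.1 h3)
    subst h4
    rw [hmin0 V hp, mul_zero, add_zero] at h1
    exact ⟨hp, hVy, h1⟩

/-! ### Steps along a minimal solution -/

theorem le_numSteps_mul {τ : ℝ} (hτ : 0 < τ) (T : ℝ) : T ≤ numSteps τ T * τ := by
  have hne : {n : ℕ | T ≤ n * τ}.Nonempty := by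
    obtain ⟨n, hn⟩ := exists_nat_gt (T / τ)
    exact ⟨n, ((div_lt_iff₀ hτ).1 hn).le⟩
  exact Nat.sInf_mem hne

theorem mul_lt_of_lt_numSteps {τ T : ℝ} {n : ℕ} (hn : n < numSteps τ T) : n * τ < T := by
  have := Nat.notMem_of_lt_sInf hn
  simpa using this

theorem numSteps_mul_lt {τ T : ℝ} (hτ : 0 < τ) (hT : 0 < T) : numSteps τ T * τ < T + τ := by
  rcases Nat.eq_zero_or_pos (numSteps τ T) with h | h
  · rw [h]
    push_cast
    linarith
  · have := mul_lt_of_lt_numSteps (τ := τ) (T := T) (n := numSteps τ T - 1) (by omega)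
    rw [Nat.cast_sub h] at this
    push_cast at this
    linarith

/-- Steps from sample points lead to later sample points, close to the next one, and do not leave
an almost critical final sample point. -/
structure StepsFollow (φ : H → ℝ) (u : ℝ → H) (ε τ S : ℝ) : Prop where
  exists_isStep : ∀ j < numSteps τ S, ∃ V, IsStep τ (penalized φ u (12 * ε) τ S) (u (j * τ)) V
  eq_of_isStep : ∀ j < numSteps τ S, ∀ V, IsStep τ (penalized φ u (12 * ε) τ S) (u (j * τ)) V →
    ∃ k : ℕ, j + 1 ≤ k ∧ k ≤ numSteps τ S ∧ V = u (k * τ) ∧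
      ‖V - u ((j + 1) * τ)‖ ≤ 4 * ε * τ
  exists_isStep_final : ‖gradient φ (u (numSteps τ S * τ))‖ ≤ ε →
    ∃ V, IsStep τ (penalized φ u (12 * ε) τ S) (u (numSteps τ S * τ)) V
  eq_of_isStep_final : ‖gradient φ (u (numSteps τ S * τ))‖ ≤ ε →
    ∀ V, IsStep τ (penalized φ u (12 * ε) τ S) (u (numSteps τ S * τ)) V →
      V = u (numSteps τ S * τ)

variable {u : ℝ → H}

/-- By Cauchy-Schwarz, the quadratic term costs at most half of the energy dissipated by `u` during
the step; the other half is a genuine gain over staying put. -/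
theorem IsSolution.stepFun_le (hφ : ContDiff ℝ 1 φ) (hu : IsSolution φ u) {t τ : ℝ} (ht : 0 ≤ t)
    (hτ : 0 < τ) :
    stepFun τ φ (u t) (u (t + τ)) ≤ φ (u t) - (φ (u t) - φ (u (t + τ))) / 2 := by
  have h := hu.norm_sub_sq_le hφ ht (b := t + τ) (by linarith)
  rw [add_sub_cancel_left] at h
  have h1 : 1 / (2 * τ) * ‖u (t + τ) - u t‖ ^ 2 ≤
      1 / (2 * τ) * (τ * (φ (u t) - φ (u (t + τ)))) := by gcongr
  have h2 : 1 / (2 * τ) * (τ * (φ (u t) - φ (u (t + τ)))) = (φ (u t) - φ (u (t + τ))) / 2 := by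
    field_simp
  rw [stepFun]
  linarith

theorem IsSolution.eventually_stepsFollow (hφ : ContDiff ℝ 1 φ)
    (hlow : QuadraticLowerBound φ) (hu : IsSolution φ u) {ε S : ℝ} (hε : 0 < ε)
    (hS : 0 < S) : ∀ᶠ τ in 𝓝[>] (0 : ℝ), StepsFollow φ u ε τ S := by
  set K := u '' Icc 0 (S + 1) with hKdef
  have hK : IsCompact K := hu.isCompact_image _
  obtain ⟨δ, hδ, hosc⟩ := exists_gradient_sub_le hφ hK hε
  obtain ⟨M, hM, hMb⟩ := hu.exists_gradient_le hφ (S + 1)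
  have small : ∀ C : ℝ, ∀ᶠ τ in 𝓝[>] (0 : ℝ), C * τ < δ := fun C => by
    have : Continuous fun τ : ℝ => C * τ := by fun_prop
    have h := this.tendsto 0
    rw [mul_zero] at h
    exact (h.mono_left nhdsWithin_le_nhds).eventually_lt_const hδ
  filter_upwards [self_mem_nhdsWithin, small (8 * ε), small M,
    hlow.eventually_stepFun_lt hφ.continuous hK hδ M,
    (mem_nhdsWithin_of_mem_nhds (Iio_mem_nhds one_pos) : Iio 1 ∈ 𝓝[>] (0 : ℝ))]
    with τ hτ h8 hMτ hfar hτ1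
  have hτ : 0 < τ := hτ
  have hτ1 : τ < 1 := hτ1
  set N := numSteps τ S with hN
  have hNS : N * τ < S + 1 := (numSteps_mul_lt hτ hS).trans (by linarith)
  have htime : ∀ k : ℕ, k ≤ N → (k : ℝ) * τ ∈ Icc 0 (S + 1) := fun k hk => by
    have : (k : ℝ) * τ ≤ N * τ := by gcongr
    exact ⟨by positivity, by linarith⟩
  have hRK : sampledRange u τ S ⊆ K := by
    rintro x ⟨n, hn, rfl⟩
    exact ⟨_, htime n hn, rfl⟩
  have hRc := (sampledRange_finite u τ S).isCompact
  have hmem : ∀ k : ℕ, k ≤ N → u (k * τ) ∈ sampledRange u τ S := fun k hk => ⟨k, hk, rfl⟩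
  have hanti : ∀ {i j : ℕ}, i ≤ j → φ (u (j * τ)) ≤ φ (u (i * τ)) := fun {i j} hij =>
    hu.energy_anti hφ (by positivity) (by gcongr)
  have inner : ∀ j < N,
      (∃ V, IsStep τ (penalized φ u (12 * ε) τ S) (u (j * τ)) V) ∧
      ∀ V, IsStep τ (penalized φ u (12 * ε) τ S) (u (j * τ)) V →
        V ∈ sampledRange u τ S ∧ ‖V - u ((j + 1 : ℕ) * τ)‖ ≤ 4 * ε * τ ∧
          stepFun τ φ (u (j * τ)) V ≤ stepFun τ φ (u (j * τ)) (u ((j + 1 : ℕ) * τ)) := by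
    intro j hj
    have hj0 : (0 : ℝ) ≤ j * τ := by positivity
    have hjj : (j : ℝ) * τ ≤ (j + 1 : ℕ) * τ := by gcongr; omega
    have hlen : ((j + 1 : ℕ) : ℝ) * τ - j * τ = τ := by push_cast; ring
    have hle := (htime (j + 1) hj).2
    have hMb' : ∀ r ∈ Icc ((j : ℝ) * τ) ((j + 1 : ℕ) * τ), ‖gradient φ (u r)‖ ≤ M :=
      fun r hr => hMb r ⟨hj0.trans hr.1, hr.2.trans hle⟩
    have hy := hmem (j + 1) hj
    refine exists_isStep_and_forall_mem hφ hRc hτ hε (fun p hp => hosc p (hRK hp)) h8.le hy ?_ ?_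
    · have := hu.norm_sub_add_smul_le (a := j * τ) (b := (j + 1 : ℕ) * τ)
        (c := gradient φ (u ((j + 1 : ℕ) * τ))) (η := ε) hj0 hjj fun r hr => by
          refine hosc _ (hRK hy) _ ?_
          have h1 := hu.norm_sub_le (hj0.trans hr.1) hr.2 fun q hq =>
            hMb' q ⟨hr.1.trans hq.1, hq.2⟩
          rw [norm_sub_rev] at h1
          refine h1.trans (le_trans ?_ hMτ.le)
          gcongr
          linarith [hr.1]
      rwa [hlen] at this
    · refine hfar _ (hRK (hmem j hj.le)) _ (hRK hy) ?_
      have h1 := hu.norm_sub_le hj0 hjj hMb'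
      rwa [hlen] at h1
  have final (hgrad : ‖gradient φ (u (N * τ))‖ ≤ ε) :
      (∃ V, IsStep τ (penalized φ u (12 * ε) τ S) (u (N * τ)) V) ∧
      ∀ V, IsStep τ (penalized φ u (12 * ε) τ S) (u (N * τ)) V →
        V ∈ sampledRange u τ S ∧ ‖V - u (N * τ)‖ ≤ 4 * ε * τ ∧
          stepFun τ φ (u (N * τ)) V ≤ stepFun τ φ (u (N * τ)) (u (N * τ)) := by
    have hy := hmem N le_rfl
    refine exists_isStep_and_forall_mem hφ hRc hτ hε (fun p hp => hosc p (hRK hp)) h8.le hy ?_ ?_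
    · rw [sub_self, zero_add, norm_smul, Real.norm_of_nonneg hτ.le, mul_comm]
      gcongr
    · refine hfar _ (hRK hy) _ (hRK hy) ?_
      rw [sub_self, norm_zero]
      positivity
  refine ⟨fun j hj => (inner j hj).1, fun j hj V hV => ?_, fun h => (final h).1, fun h V hV => ?_⟩
  · obtain ⟨⟨k, hk, rfl⟩, hclose, hle⟩ := (inner j hj).2 V hV
    have hj0 : (0 : ℝ) ≤ j * τ := by positivity
    have hcast : ((j + 1 : ℕ) : ℝ) * τ = j * τ + τ := by push_cast; ring
    have h1 := hu.stepFun_le hφ hj0 hτ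
    rw [← hcast] at h1
    have hsq : φ (u (k * τ)) ≤ stepFun τ φ (u (j * τ)) (u (k * τ)) := by
      rw [stepFun]
      have : 0 ≤ 1 / (2 * τ) * ‖u (k * τ) - u (j * τ)‖ ^ 2 := by positivity
      linarith
    have h2 := hanti (Nat.le_succ j)
    by_cases hlt : φ (u (k * τ)) < φ (u (j * τ))
    · have hjk : j < k := by
        by_contra! hcon
        exact absurd (hanti hcon) (not_le.2 hlt)
      exact ⟨k, hjk, hk, rfl, by exact_mod_cast hclose⟩
    -- If no energy is lost, `V` is the starting point, and then `u` itself dissipates nothing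
    -- during this step. It is constant there, so `V` is also the next sample and the index still
    -- advances.
    · have hx : u (k * τ) = u (j * τ) :=
        eq_of_stepFun_le hτ (not_lt.1 hlt) (by simp only [Nat.succ_eq_add_one] at h2; linarith)
      have hy : u ((j + 1 : ℕ) * τ) = u (j * τ) :=
        hu.eq_of_energy_eq hφ hj0 (by rw [hcast]; linarith) (by linarith)
      exact ⟨j + 1, le_rfl, hj, hx.trans hy.symm, by exact_mod_cast hclose⟩
  · obtain ⟨⟨k, hk, rfl⟩, -, hle⟩ := (final h).2 V hV
    refine eq_of_stepFun_le hτ (hanti hk) (hle.trans ?_)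
    simp [stepFun, hN]

end PenalizedStep

section Tracking

variable {H : Type*} [NormedAddCommGroup H] [InnerProductSpace ℝ H] [CompleteSpace H]
  {φ : H → ℝ} {u : ℝ → H}

/-! ### Slow time -/

/-- The time spent by `u` in `[0, t]`, weighted so that times of small speed count most. -/
noncomputable def slowTime (φ : H → ℝ) (u : ℝ → H) (δ t : ℝ) : ℝ :=
  ∫ s in 0..t, δ / (δ + ‖gradient φ (u s)‖ ^ 2)

section SlowTime

variable {δ a b : ℝ}

theorem IsSolution.continuousOn_slow (hφ : ContDiff ℝ 1 φ) (hu : IsSolution φ u) (hδ : 0 < δ) :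
    ContinuousOn (fun s => δ / (δ + ‖gradient φ (u s)‖ ^ 2)) (Ici 0) :=
  continuousOn_const.div (continuousOn_const.add ((hu.continuousOn_gradient hφ).norm.pow 2))
    fun s _ => by positivity

theorem IsSolution.integrable_slow (hφ : ContDiff ℝ 1 φ) (hu : IsSolution φ u) (hδ : 0 < δ)
    (ha : 0 ≤ a) (hab : a ≤ b) :
    IntervalIntegrable (fun s => δ / (δ + ‖gradient φ (u s)‖ ^ 2)) volume a b :=
  ((hu.continuousOn_slow hφ hδ).mono fun _ h => ha.trans h.1).intervalIntegrable_of_Icc hab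

theorem IsSolution.slowTime_sub (hφ : ContDiff ℝ 1 φ) (hu : IsSolution φ u) (hδ : 0 < δ)
    (ha : 0 ≤ a) (hab : a ≤ b) :
    slowTime φ u δ b - slowTime φ u δ a = ∫ s in a..b, δ / (δ + ‖gradient φ (u s)‖ ^ 2) :=
  intervalIntegral.integral_interval_sub_left (hu.integrable_slow hφ hδ le_rfl (ha.trans hab))
    (hu.integrable_slow hφ hδ le_rfl ha)

theorem IsSolution.slowTime_mono (hφ : ContDiff ℝ 1 φ) (hu : IsSolution φ u) (hδ : 0 < δ)
    (ha : 0 ≤ a) (hab : a ≤ b) : slowTime φ u δ a ≤ slowTime φ u δ b := by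
  rw [← sub_nonneg, hu.slowTime_sub hφ hδ ha hab]
  exact intervalIntegral.integral_nonneg hab fun t _ => by positivity

/-- Elapsed time is bounded by slow time and dissipated energy. -/
theorem IsSolution.sub_le_slowTime (hφ : ContDiff ℝ 1 φ) (hu : IsSolution φ u) (hδ : 0 < δ)
    (ha : 0 ≤ a) (hab : a ≤ b) :
    b - a ≤ slowTime φ u δ b - slowTime φ u δ a + (φ (u a) - φ (u b)) / δ := by
  rw [hu.slowTime_sub hφ hδ ha hab, ← hu.integral_gradient_sq hφ ha hab,
    ← intervalIntegral.integral_div, ← intervalIntegral.integral_add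
      (hu.integrable_slow hφ hδ ha hab) ((hu.integrable_gradient_sq hφ ha hab).div_const δ)]
  have := intervalIntegral.integral_mono_on (μ := volume) hab
    (intervalIntegrable_const (c := (1 : ℝ)))
    ((hu.integrable_slow hφ hδ ha hab).add ((hu.integrable_gradient_sq hφ ha hab).div_const δ))
    fun t _ => by
      set w := ‖gradient φ (u t)‖ ^ 2
      have hw : 0 ≤ w := sq_nonneg _
      have e : δ / (δ + w) + w / δ - 1 = w ^ 2 / ((δ + w) * δ) := by
        have : δ + w ≠ 0 := by positivity
        field_simp
        ring
      have : 0 ≤ w ^ 2 / ((δ + w) * δ) := by positivity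
      linarith
  simpa using this

/-- Dominated convergence with bound `1`: the integrand tends to `0` wherever the gradient is
nonzero, and stays `1` at critical times. -/
theorem IsSolution.tendsto_slowTime (hφ : ContDiff ℝ 1 φ) (hu : IsSolution φ u) {L : ℝ}
    (hL : 0 ≤ L) (h0 : volume (criticalTimes φ u L) = 0) :
    Tendsto (fun δ => slowTime φ u δ L) (𝓝[>] 0) (𝓝 0) := by
  have h := intervalIntegral.tendsto_integral_filter_of_dominated_convergence (μ := volume)
    (l := 𝓝[>] (0 : ℝ)) (a := 0) (b := L)
    (F := fun δ s => δ / (δ + ‖gradient φ (u s)‖ ^ 2)) (f := fun _ => 0) (fun _ => (1 : ℝ))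
    (by
      filter_upwards [self_mem_nhdsWithin] with δ hδ
      rw [uIoc_of_le hL]
      exact (hu.integrable_slow hφ hδ le_rfl hL).1.aestronglyMeasurable)
    (by
      filter_upwards [self_mem_nhdsWithin] with δ hδ
      have hδ : 0 < δ := hδ
      refine ae_of_all _ fun s _ => ?_
      rw [Real.norm_of_nonneg (by positivity), div_le_one (by positivity)]
      linarith [sq_nonneg ‖gradient φ (u s)‖])
    intervalIntegrable_const
    (by
      filter_upwards [measure_eq_zero_iff_ae_notMem.1 h0] with s hs hsL
      rw [uIoc_of_le hL] at hsL
      have hg : gradient φ (u s) ≠ 0 := fun hg => hs ⟨⟨hsL.1.le, hsL.2⟩, hg⟩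
      have hc : ContinuousAt (fun δ : ℝ => δ / (δ + ‖gradient φ (u s)‖ ^ 2)) 0 :=
        continuousAt_id.div (by fun_prop) (by simpa using hg)
      have := hc.tendsto
      simp only [zero_div] at this
      exact this.mono_left nhdsWithin_le_nhds)
  simpa [slowTime] using h

end SlowTime

/-- Up to an arbitrarily short time, a minimal solution moves at almost every time before it becomes
stationary. -/
theorem IsMinimalSolution.exists_moving_time (hφ : ContDiff ℝ 1 φ) (hu : IsMinimalSolution φ u)
    {T η : ℝ} (hT : 0 ≤ T) (hη : 0 < η) :
    ∃ L ∈ Icc 0 T, volume (criticalTimes φ u L) = 0 ∧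
      (L = T ∨ ∀ t, L + η ≤ t → u t = u (L + η)) := by
  by_cases hne : ∃ t, T ≤ t ∧ u t ≠ u T
  · exact ⟨T, right_mem_Icc.2 hT, hu.ae_gradient_ne_zero hφ hT hne, Or.inl rfl⟩
  push Not at hne
  set Z := {t | t ∈ Icc 0 T ∧ ∀ s, t ≤ s → u s = u t} with hZ
  have hZne : Z.Nonempty := ⟨T, right_mem_Icc.2 hT, hne⟩
  have hZb : BddBelow Z := ⟨0, fun t ht => ht.1.1⟩
  have h0 : 0 ≤ sInf Z := le_csInf hZne fun t ht => ht.1.1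
  have h1 : sInf Z ≤ T := csInf_le hZb ⟨right_mem_Icc.2 hT, hne⟩
  have hlt : sInf Z < max 0 (sInf Z - η / 2) + η := by
    linarith [le_max_right 0 (sInf Z - η / 2)]
  -- Stepping back `η / 2` from the infimum of the stationary times gives a time before
  -- stationarity, while adding `η` passes the infimum. If the step back would leave `[0, T]`, then
  -- `L = 0` and the critical times lie in `{0}`.
  refine ⟨max 0 (sInf Z - η / 2), ⟨le_max_left _ _, max_le hT (by linarith)⟩, ?_, Or.inr ?_⟩
  · rcases le_or_gt (sInf Z - η / 2) 0 with h | h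
    · rw [max_eq_left h]
      refine measure_mono_null (t := {0}) (fun t ht => ?_) (by simp)
      exact le_antisymm ht.1.2 ht.1.1
    · rw [max_eq_right h.le]
      refine hu.ae_gradient_ne_zero hφ h.le ?_
      by_contra! hcon
      have := csInf_le hZb (show sInf Z - η / 2 ∈ Z from ⟨⟨h.le, by linarith⟩, hcon⟩)
      linarith
  · obtain ⟨z, hz, hzl⟩ := exists_lt_of_csInf_lt hZne hlt
    intro t ht
    rw [hz.2 t (hzl.le.trans ht), hz.2 _ hzl.le]

/-! ### Discrete solutions track minimal solutions -/

/-- One step of a chain of samples increases the clamped time minus slow time only slightly more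
than the time step. -/
theorem IsSolution.clamped_sub_slowTime_le (hφ : ContDiff ℝ 1 φ) (hu : IsSolution φ u)
    {δ s t E τ L : ℝ} (hδ : 0 < δ) (hs : 0 ≤ s) (hτ : 0 ≤ τ) (hE : 0 ≤ E) (hL : 0 ≤ L)
    (hst : s + τ ≤ t)
    (hen : s < L → φ (u (s + τ)) - φ (u t) ≤ E) :
    min t L - slowTime φ u δ (min t L) ≤ min s L - slowTime φ u δ (min s L) + τ + E / δ := by
  have hEδ : 0 ≤ E / δ := by positivity
  rcases le_or_gt L s with h | h
  · rw [min_eq_right h, min_eq_right (by linarith)]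
    linarith
  rw [min_eq_left h.le]
  -- The first leg lasts at most `τ`; the time of the remaining skip is charged to slow time and to
  -- `E / δ`.
  have h1 : s ≤ min (s + τ) L := le_min (by linarith) h.le
  have h2 : min (s + τ) L ≤ min t L := min_le_min_right _ hst
  have h3 := hu.sub_le_slowTime hφ hδ (hs.trans h1) h2
  have h4 := hu.slowTime_mono hφ hδ hs h1
  have h5 : min (s + τ) L ≤ s + τ := min_le_left _ _
  have h6 : φ (u (min (s + τ) L)) - φ (u (min t L)) ≤ E := by
    rcases le_total L (s + τ) with h7 | h7
    · rw [min_eq_right h7, min_eq_right (h7.trans hst)]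
      linarith
    · rw [min_eq_left h7]
      have := hu.energy_anti hφ (le_min (hs.trans (by linarith)) hL) (min_le_left t L)
      linarith [hen h]
  have h7 := div_le_div_of_nonneg_right h6 hδ.le
  linarith

/-- Discrete solutions stay close to a minimal solution on bounded time intervals. -/
theorem IsMinimalSolution.eventually_tracking (hφ : ContDiff ℝ 1 φ) (hu : IsMinimalSolution φ u)
    {ε S : ℝ → ℝ} (hεpos : ∀ τ, 0 < ε τ) (hε : Tendsto ε (𝓝[>] 0) (𝓝 0))
    (hS : Tendsto S (𝓝[>] 0) atTop)
    (hfollow : ∀ᶠ τ in 𝓝[>] (0 : ℝ), StepsFollow φ u (ε τ) τ (S τ))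
    (hend : (∀ᶠ τ in 𝓝[>] (0 : ℝ), ‖gradient φ (u (numSteps τ (S τ) * τ))‖ ≤ ε τ) ∨
      ∀ L, 0 ≤ L → ∃ t, L ≤ t ∧ u t ≠ u L)
    {T η : ℝ} (hT : 0 < T) (hη : 0 < η) :
    ∀ᶠ τ in 𝓝[>] (0 : ℝ), ∀ m ≤ numSteps τ T, ∀ V : ℕ → H, V 0 = u 0 →
      (∀ k < m, IsMinStep τ (penalized φ u (12 * ε τ) τ (S τ)) V k) →
      ‖V m - u (m * τ)‖ ≤ η ∧
        ∃ W, IsStep τ (penalized φ u (12 * ε τ) τ (S τ)) (V m) W := by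
  obtain ⟨M, hM, hMb⟩ := hu.1.exists_gradient_le hφ (T + 4)
  set η' := min (1 / 2) (η / (2 * M)) with hη'
  have hη'pos : 0 < η' := by positivity
  have hη'1 : η' ≤ 1 / 2 := min_le_left _ _
  have hη'M : M * (2 * η') ≤ η := by
    have := min_le_right (1 / 2) (η / (2 * M))
    rw [← hη', le_div_iff₀ (by positivity)] at this
    linarith
  obtain ⟨L, ⟨hL0, hLT⟩, hnull, hstat⟩ :=
    hu.exists_moving_time hφ (T := T + 2) (by linarith) hη'pos
  -- Half of the admissible lead `η'` is slow time; the other half is the accumulated skip energy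
  -- over `δ`, made small through `ε` once `δ` is fixed.
  obtain ⟨δ, hδ, hδslow⟩ : ∃ δ : ℝ, 0 < δ ∧ slowTime φ u δ L < η' / 2 := by
    have := ((hu.1.tendsto_slowTime hφ hL0 hnull).eventually_lt_const (half_pos hη'pos)).and
      self_mem_nhdsWithin
    obtain ⟨δ, h1, h2⟩ := this.exists
    exact ⟨δ, h2, h1⟩
  obtain ⟨δ₁, hδ₁, hosc⟩ := exists_gradient_sub_le hφ (hu.1.isCompact_image (T + 4)) one_pos
  have hend' : ∀ᶠ τ in 𝓝[>] (0 : ℝ), L = T + 2 ∨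
      ‖gradient φ (u (numSteps τ (S τ) * τ))‖ ≤ ε τ := by
    rcases hend with h | h
    · exact h.mono fun _ => Or.inr
    · refine Eventually.of_forall fun _ => Or.inl (hstat.resolve_right fun hst => ?_)
      obtain ⟨t, ht, hne⟩ := h (L + η') (by linarith)
      exact hne (hst t ht)
  have hE : ∀ᶠ τ in 𝓝[>] (0 : ℝ), (T + 1) * ((M + 1) * (4 * ε τ) / δ) < η' / 2 := by
    have : Tendsto (fun τ => (T + 1) * ((M + 1) * (4 * ε τ) / δ)) (𝓝[>] 0)
        (𝓝 ((T + 1) * ((M + 1) * (4 * 0) / δ))) :=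
      (((hε.const_mul 4).const_mul (M + 1)).div_const δ).const_mul (T + 1)
    refine this.eventually_lt_const ?_
    simpa using hη'pos
  filter_upwards [self_mem_nhdsWithin, hfollow, hend', hE,
    hε.eventually_lt_const (show (0 : ℝ) < δ₁ / 4 by positivity),
    hS.eventually_ge_atTop (T + 4),
    (mem_nhdsWithin_of_mem_nhds (Iio_mem_nhds one_pos) : Iio 1 ∈ 𝓝[>] (0 : ℝ))]
    with τ hτ hf hend hE hεδ hS hτ1 m hm V hV0 hV
  have hτ : 0 < τ := hτ
  have hτ1 : τ < 1 := hτ1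
  have hε0 := hεpos τ
  set N := numSteps τ (S τ) with hN
  have hNS : T + 4 ≤ N * τ := hS.trans (le_numSteps_mul hτ _)
  set g : ℝ → ℝ := fun t => min t L - slowTime φ u δ (min t L) with hg
  have htime : ∀ n ≤ numSteps τ T, n * τ < T + 1 := fun n hn => by
    have h1 := numSteps_mul_lt hτ hT
    have h2 : (n : ℝ) * τ ≤ numSteps τ T * τ := by gcongr
    linarith
  -- The index `k` of the sample occupied at step `n` never lags until the samples end, whence `min
  -- n N`, and its clamped time minus slow time exceeds `n * τ` only by the skip costs.
  set Inv : ℕ → ℕ → Prop := fun n k => k ≤ N ∧ V n = u (k * τ) ∧ min n N ≤ k ∧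
    g (k * τ) ≤ n * τ + n * τ * ((M + 1) * (4 * ε τ) / δ) with hInv
  have hclamp : ∀ n ≤ numSteps τ T, ∀ k, Inv n k → min (k * τ) L ≤ n * τ + η' := by
    rintro n hn k ⟨-, -, -, hgk⟩
    have h1 := htime n hn
    have h2 : (n : ℝ) * τ * ((M + 1) * (4 * ε τ) / δ) ≤
        (T + 1) * ((M + 1) * (4 * ε τ) / δ) := by gcongr
    have h3 := hu.1.slowTime_mono hφ hδ (le_min (by positivity) hL0) (min_le_right (k * τ) L)
    simp only [hg] at hgk
    linarith
  have hlast : ∀ n ≤ numSteps τ T, ∀ k, Inv n k → k < N ∨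
      (k = N ∧ ‖gradient φ (u (N * τ))‖ ≤ ε τ) := by
    intro n hn k hk
    rcases hk.1.lt_or_eq with h | h
    · exact Or.inl h
    -- If `L = T + 2`, the lead is too small for the last sample to be reached; otherwise that
    -- sample is almost critical.
    · refine Or.inr ⟨h, hend.resolve_left fun hL => ?_⟩
      have h1 := hclamp n hn k hk
      rw [h, min_eq_right (by linarith)] at h1
      linarith [htime n hn]
  have hinv : ∀ n ≤ m, ∃ k, Inv n k := by
    intro n
    induction n with
    | zero =>
      refine fun _ => ⟨0, Nat.zero_le _, by simpa using hV0, by simp, ?_⟩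
      simp [hg, hL0, slowTime]
    | succ n ih =>
      intro hn
      obtain ⟨k, hk⟩ := ih (by omega)
      have hstep : IsStep τ (penalized φ u (12 * ε τ) τ (S τ)) (V n) (V (n + 1)) := hV n hn
      rw [hk.2.1] at hstep
      have hincr : 0 ≤ τ * ((M + 1) * (4 * ε τ) / δ) := by positivity
      rcases hlast n (by omega) k hk with hkN | ⟨rfl, hgrad⟩
      · obtain ⟨k', hkk', hk'N, hVk', hclose⟩ := hf.eq_of_isStep k hkN _ hstep
        refine ⟨k', hk'N, hVk', ?_, ?_⟩
        · have := hk.2.2.1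
          omega
        · have hkk : (k : ℝ) * τ + τ ≤ k' * τ := by
            have : ((k + 1 : ℕ) : ℝ) * τ ≤ k' * τ := by gcongr
            push_cast at this
            linarith
          have h1 := hu.1.clamped_sub_slowTime_le hφ (s := k * τ) (t := k' * τ)
            (E := (M + 1) * (4 * ε τ * τ)) hδ (by positivity) hτ.le (by positivity) hL0 hkk
            fun hlt => by
              -- Skip energy: near the sample the gradient has norm at most `M + 1`, and the skip
              -- has length at most `4 * ε τ * τ`.
              rw [hVk', add_one_mul] at hclose
              have hmem : (k : ℝ) * τ + τ ∈ Icc 0 (T + 4) := ⟨by positivity, by linarith⟩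
              have hd : ‖u (k' * τ) - u (k * τ + τ)‖ ≤ δ₁ := by
                refine hclose.trans ?_
                have : 4 * ε τ * τ ≤ 4 * ε τ * 1 := by gcongr
                linarith
              have h2 := (abs_le.1 (abs_sub_inner_gradient_le hφ
                (hosc _ ⟨_, hmem, rfl⟩) hd)).1
              have h3 := neg_le_of_abs_le (abs_real_inner_le_norm (gradient φ (u (k * τ + τ)))
                (u (k' * τ) - u (k * τ + τ)))
              have h4 : ‖gradient φ (u (k * τ + τ))‖ * ‖u (k' * τ) - u (k * τ + τ)‖ ≤
                M * ‖u (k' * τ) - u (k * τ + τ)‖ := by gcongr; exact hMb _ hmem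
              have h5 : (M + 1) * ‖u (k' * τ) - u (k * τ + τ)‖ ≤ (M + 1) * (4 * ε τ * τ) := by
                gcongr
              linarith
          have h2 := hk.2.2.2
          have e : (M + 1) * (4 * ε τ * τ) / δ = τ * ((M + 1) * (4 * ε τ) / δ) := by ring
          rw [e] at h1
          simp only [hg] at h2 ⊢
          push_cast
          linarith
      · refine ⟨N, le_rfl, hf.eq_of_isStep_final hgrad _ hstep, min_le_right _ _, ?_⟩
        have h2 := hk.2.2.2
        push_cast
        linarith
  obtain ⟨k, hk⟩ := hinv m le_rfl
  refine ⟨?_, ?_⟩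
  · have hmT := htime m hm
    have hmN : m < N := by
      have : (m : ℝ) * τ < N * τ := by linarith
      exact_mod_cast lt_of_mul_lt_mul_right this hτ.le
    have hmk : (m : ℝ) * τ ≤ k * τ := by
      have := hk.2.2.1
      rw [min_eq_left hmN.le] at this
      gcongr
    have hm0 : (0 : ℝ) ≤ m * τ := by positivity
    have hcl := hclamp m hm k hk
    rw [hk.2.1]
    rcases le_or_gt (k * τ) L with h | h
    · rw [min_eq_left h] at hcl
      refine (hu.1.norm_sub_le_abs (T := T + 4) ⟨hm0, by linarith⟩ ⟨by linarith, by linarith⟩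
        hMb).trans (le_trans ?_ hη'M)
      rw [abs_of_nonneg (by linarith)]
      gcongr
      linarith
    · rw [min_eq_right h.le] at hcl
      have hst := hstat.resolve_left fun hL => by linarith
      -- Past `L + η'` nothing moves, so both times may be cut there; they then differ by at most `2
      -- * η'`.
      have hcut : ∀ t, u t = u (min t (L + η')) := fun t => by
        rcases le_total t (L + η') with ht | ht
        · rw [min_eq_left ht]
        · rw [min_eq_right ht, hst t ht]
      rw [hcut (k * τ), hcut (m * τ)]
      have h1 := min_le_right ((k : ℝ) * τ) (L + η')
      have h2 := min_le_right ((m : ℝ) * τ) (L + η')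
      have h3 : L ≤ min ((k : ℝ) * τ) (L + η') := le_min h.le (by linarith)
      have h4 : L - η' ≤ min ((m : ℝ) * τ) (L + η') := le_min (by linarith) (by linarith)
      have h5 : 0 ≤ min ((m : ℝ) * τ) (L + η') := le_min hm0 (by linarith)
      refine (hu.1.norm_sub_le_abs (T := T + 4) ⟨h5, by linarith⟩ ⟨by linarith, by linarith⟩
        hMb).trans (le_trans ?_ hη'M)
      gcongr
      rw [abs_le]
      constructor <;> linarith
  · rw [hk.2.1]
    rcases hlast m hm k hk with h | ⟨rfl, hgrad⟩
    · exact hf.exists_isStep k h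
    · exact hf.exists_isStep_final hgrad

end Tracking

section Convergence

/-! ### Approximation on the half-line and on compact intervals -/

/-- Diagonal selection of a slowly growing index. -/
theorem exists_tendsto_atTop_of_forall_eventually {P : ℕ → ℝ → Prop}
    (h : ∀ n, ∀ᶠ τ in 𝓝[>] (0 : ℝ), P n τ) :
    ∃ ν : ℝ → ℕ, Tendsto ν (𝓝[>] 0) atTop ∧ ∀ᶠ τ in 𝓝[>] (0 : ℝ), P (ν τ) τ := by
  classical
  have hinv : Tendsto (fun τ : ℝ => ⌊τ⁻¹⌋₊) (𝓝[>] 0) atTop :=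
    tendsto_nat_floor_atTop.comp tendsto_inv_nhdsGT_zero
  refine ⟨fun τ => Nat.findGreatest (fun n => P n τ) ⌊τ⁻¹⌋₊, ?_, ?_⟩
  · refine tendsto_atTop.2 fun n => ?_
    filter_upwards [h n, hinv.eventually_ge_atTop n] with τ h1 h2
    exact Nat.le_findGreatest h2 h1
  · filter_upwards [h 0] with τ h1
    exact Nat.findGreatest_spec (P := fun n => P n τ) (Nat.zero_le _) h1

theorem tendsto_zero_of_eventually_le_ofReal {f : ℝ → ENNReal} {l : Filter ℝ}
    (h : ∀ η : ℝ, 0 < η → ∀ᶠ τ in l, f τ ≤ ENNReal.ofReal η) : Tendsto f l (𝓝 0) := by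
  refine ENNReal.tendsto_nhds_zero.2 fun e he => ?_
  obtain ⟨r, -, hr, hre⟩ := ENNReal.lt_iff_exists_real_btwn.1 he
  exact (h r (by simpa using hr)).mono fun τ hτ => hτ.trans hre.le

/-! ### From minimizing sequences to discrete solutions and their distances. -/

section Sequences

variable {H : Type*} [NormedAddCommGroup H]

open Classical in
/-- A sequence which makes a step of the scheme whenever this is possible. -/
noncomputable def stepSeq (τ : ℝ) (ψ : H → ℝ) (u₀ : H) : ℕ → H
  | 0 => u₀
  | n + 1 => if h : ∃ V, IsStep τ ψ (stepSeq τ ψ u₀ n) V then h.choose else stepSeq τ ψ u₀ n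

theorem isMinStep_stepSeq {τ : ℝ} {ψ : H → ℝ} {u₀ : H} {n : ℕ}
    (h : ∃ V, IsStep τ ψ (stepSeq τ ψ u₀ n) V) : IsMinStep τ ψ (stepSeq τ ψ u₀) n := by
  have h1 : IsStep τ ψ (stepSeq τ ψ u₀ n) (stepSeq τ ψ u₀ (n + 1)) := by
    rw [stepSeq, dif_pos h]
    exact h.choose_spec
  exact h1

theorem natCeil_div_eq {τ t : ℝ} (hτ : 0 < τ) {k : ℕ} (ht : t ∈ Ioc (k * τ) ((k + 1) * τ)) :
    ⌈t / τ⌉₊ = k + 1 := by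
  rw [Nat.ceil_eq_iff (by omega), lt_div_iff₀ hτ, div_le_iff₀ hτ]
  simpa using ht

theorem exists_mem_Ioc_step {τ t : ℝ} (hτ : 0 < τ) (ht : 0 < t) :
    ∃ k : ℕ, t ∈ Ioc (k * τ) ((k + 1) * τ) := by
  have hpos : 0 < ⌈t / τ⌉₊ := Nat.ceil_pos.2 (div_pos ht hτ)
  obtain ⟨k, hk⟩ := Nat.exists_eq_add_one_of_ne_zero hpos.ne'
  rw [Nat.ceil_eq_iff (by omega), lt_div_iff₀ hτ, div_le_iff₀ hτ] at hk
  exact ⟨k, by simpa using hk⟩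

theorem DSFin_nonempty {τ T : ℝ} {ψ : H → ℝ} {u₀ : H} (hτ : 0 < τ) {V : ℕ → H}
    (hV : V ∈ MSFin τ ψ u₀ (numSteps τ T)) : (DSFin τ ψ u₀ T).Nonempty :=
  ⟨fun t => V ⌈t / τ⌉₊, V, hV, by simpa using hV.1, fun k t ht _ => by
    simp only [natCeil_div_eq hτ ht]⟩

theorem DS_nonempty {τ : ℝ} {ψ : H → ℝ} {u₀ : H} (hτ : 0 < τ) {V : ℕ → H}
    (hV : V ∈ MS τ ψ u₀) : (DS τ ψ u₀).Nonempty :=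
  ⟨fun t => V ⌈t / τ⌉₊, V, hV, by simpa using hV.1, fun k t ht => by
    simp only [natCeil_div_eq hτ ht]⟩

theorem DS_subset_DSFin (τ : ℝ) (ψ : H → ℝ) (u₀ : H) (T : ℝ) : DS τ ψ u₀ ⊆ DSFin τ ψ u₀ T := by
  rintro U ⟨V, hV, hU0, hU⟩
  exact ⟨V, ⟨hV.1, fun k _ => hV.2 k⟩, hU0, fun k t ht _ => hU k t ht⟩

/-- The error is the tracking error at the right end of the time step plus the motion of `u` within
that step. -/
theorem norm_sub_le_of_mem_DSFin {τ T M η : ℝ} {ψ : H → ℝ} {u : ℝ → H} (hτ : 0 < τ) (hη : 0 ≤ η)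
    (hM : 0 ≤ M) (htrack : ∀ m ≤ numSteps τ T, ∀ V : ℕ → H, V 0 = u 0 →
      (∀ k < m, IsMinStep τ ψ V k) → ‖V m - u (m * τ)‖ ≤ η)
    (hlip : ∀ s t, 0 ≤ s → s ≤ t → t ≤ T + τ → ‖u t - u s‖ ≤ M * (t - s))
    {U : ℝ → H} (hU : U ∈ DSFin τ ψ (u 0) T) {t : ℝ} (ht : t ∈ Icc 0 T) :
    ‖u t - U t‖ ≤ η + M * τ := by
  obtain ⟨V, hV, hU0, hU⟩ := hU
  rcases ht.1.eq_or_lt with rfl | htpos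
  · rw [hU0, sub_self, norm_zero]
    positivity
  obtain ⟨k, hk⟩ := exists_mem_Ioc_step hτ htpos
  have hkN : k + 1 ≤ numSteps τ T := by
    by_contra! hcon
    have h1 : (numSteps τ T : ℝ) * τ ≤ k * τ := by
      have : numSteps τ T ≤ k := by omega
      gcongr
    linarith [le_numSteps_mul hτ T, hk.1, ht.2]
  have h1 := htrack (k + 1) hkN V hV.1 fun j hj => hV.2 j (by omega)
  have h2 := hlip t ((k + 1 : ℕ) * τ) ht.1 (by push_cast; exact hk.2)
    (by push_cast; linarith [hk.1, ht.2])
  have h3 : M * ((k + 1 : ℕ) * τ - t) ≤ M * τ := by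
    gcongr
    push_cast
    linarith [hk.1]
  rw [hU k t hk ht.2, norm_sub_rev]
  have := norm_add_le (V (k + 1) - u ((k + 1 : ℕ) * τ)) (u ((k + 1 : ℕ) * τ) - u t)
  rw [sub_add_sub_cancel] at this
  linarith

theorem DFin_le {T η : ℝ} {u : ℝ → H} {𝒰 : Set (ℝ → H)} (hne : 𝒰.Nonempty)
    (h : ∀ U ∈ 𝒰, ∀ t ∈ Icc 0 T, ‖u t - U t‖ ≤ η) : DFin T u 𝒰 ≤ ENNReal.ofReal η := by
  rw [DFin, if_neg hne.ne_empty]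
  exact iSup₂_le fun U hU => iSup₂_le fun t ht =>
    ENNReal.ofReal_le_ofReal ((min_le_left _ _).trans (h U hU t ht))

/-- Beyond `T` the truncation and the weight alone bound the distance by `1 / T`. -/
theorem DInf_le {T η : ℝ} {u : ℝ → H} {𝒰 : Set (ℝ → H)} (hne : 𝒰.Nonempty) (hT : 0 < T)
    (hTη : 1 / T ≤ η) (h : ∀ U ∈ 𝒰, ∀ t ∈ Icc 0 T, ‖u t - U t‖ ≤ η) :
    DInf u 𝒰 ≤ ENNReal.ofReal η := by
  rw [DInf, if_neg hne.ne_empty]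
  refine iSup₂_le fun U hU => iSup₂_le fun t ht => ENNReal.ofReal_le_ofReal ?_
  have ht : 0 ≤ t := ht
  rcases le_total t T with htT | htT
  · have h1 : 1 / (1 + t) ≤ 1 := by
      rw [div_le_one (by positivity)]
      linarith
    exact (mul_le_of_le_one_left (by positivity) h1).trans
      ((min_le_left _ _).trans (h U hU t ⟨ht, htT⟩))
  · calc 1 / (1 + t) * min ‖u t - U t‖ 1 ≤ 1 / T * 1 := by
          gcongr
          · linarith
          · exact min_le_right _ _
      _ ≤ η := by linarith

theorem lip_penalized_le (φ : H → ℝ) (u : ℝ → H) {c : ℝ} (hc : 0 ≤ c) (τ T : ℝ) :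
    lip (fun x => penalized φ u c τ T x - φ x) ≤ ENNReal.ofReal c := by
  refine iSup_le fun x => iSup_le fun y => iSup_le fun hxy => ENNReal.ofReal_le_ofReal ?_
  have h1 : Metric.infDist y (sampledRange u τ T) ≤
      Metric.infDist x (sampledRange u τ T) + ‖y - x‖ := by
    rw [← dist_eq_norm]
    exact Metric.infDist_le_infDist_add_dist
  have h2 : 0 < ‖y - x‖ := norm_pos_iff.2 (sub_ne_zero.2 hxy.symm)
  rw [div_le_iff₀ h2]
  simp only [penalized]
  nlinarith

theorem tendsto_lip_penalized (φ : H → ℝ) (u : ℝ → H) {ε S : ℝ → ℝ} (hεpos : ∀ τ, 0 < ε τ)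
    (hε : Tendsto ε (𝓝[>] 0) (𝓝 0)) :
    Tendsto (fun τ => lip fun x => penalized φ u (12 * ε τ) τ (S τ) x - φ x) (𝓝[>] 0) (𝓝 0) := by
  refine tendsto_of_tendsto_of_tendsto_of_le_of_le tendsto_const_nhds
    (h := fun τ => ENNReal.ofReal (12 * ε τ)) ?_ (fun _ => zero_le)
    fun τ => lip_penalized_le φ u (by linarith [hεpos τ]) τ (S τ)
  simpa using ENNReal.tendsto_ofReal (hε.const_mul 12)

/-- In finite dimension the steps with small time step are possible from every point. -/
theorem QuadraticLowerBound.eventually_exists_isStep [ProperSpace H] {φ : H → ℝ}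
    (hlow : QuadraticLowerBound φ) (hφ : Continuous φ) :
    ∀ᶠ τ in 𝓝[>] (0 : ℝ), ∀ d : H → ℝ, Continuous d → (∀ x, 0 ≤ d x) →
      ∀ x, ∃ V, IsStep τ (fun z => φ z + d z) x V := by
  obtain ⟨τs, hτs, φs, hlow⟩ := hlow
  filter_upwards [self_mem_nhdsWithin,
    (mem_nhdsWithin_of_mem_nhds (Iio_mem_nhds (half_pos hτs)) : Iio (τs / 2) ∈ 𝓝[>] (0 : ℝ))]
    with τ hτ hττs d hd hd0 x
  have hτ : 0 < τ := hτ
  have hττs : τ < τs / 2 := hττs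
  have hcoef : 0 < 1 / (2 * τ) - 1 / τs := by
    rw [sub_pos]
    exact one_div_lt_one_div_of_lt (by positivity) (by linarith)
  have hcont : Continuous (stepFun τ (fun z => φ z + d z) x) := by
    unfold stepFun
    fun_prop
  refine hcont.exists_forall_le ?_
  have hlim : Tendsto (fun V : H => (1 / (2 * τ) - 1 / τs) * ‖V - x‖ ^ 2 - ‖x‖ ^ 2 / τs - φs)
      (cocompact H) atTop := by
    refine tendsto_atTop_add_const_right _ _ (tendsto_atTop_add_const_right _ _ ?_)
    refine Tendsto.const_mul_atTop hcoef ((tendsto_pow_atTop two_ne_zero).comp ?_)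
    have h1 : Tendsto (fun V : H => ‖V‖ - ‖x‖) (cocompact H) atTop :=
      tendsto_atTop_add_const_right _ _ tendsto_norm_cocompact_atTop
    exact tendsto_atTop_mono (fun V => norm_sub_norm_le V x) h1
  refine tendsto_atTop_mono (fun V => ?_) hlim
  have hV2 : ‖V‖ ^ 2 ≤ 2 * ‖V - x‖ ^ 2 + 2 * ‖x‖ ^ 2 := by
    have h5 := norm_add_le (V - x) x
    rw [sub_add_cancel] at h5
    nlinarith [sq_nonneg (‖V - x‖ - ‖x‖), norm_nonneg V]
  have h5 : 1 / (2 * τs) * ‖V‖ ^ 2 ≤ 1 / (2 * τs) * (2 * ‖V - x‖ ^ 2 + 2 * ‖x‖ ^ 2) := by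
    gcongr
  have h6 : 1 / (2 * τs) * (2 * ‖V - x‖ ^ 2 + 2 * ‖x‖ ^ 2) =
      1 / τs * ‖V - x‖ ^ 2 + ‖x‖ ^ 2 / τs := by
    field_simp
  have h7 := hlow V
  have h8 := hd0 V
  rw [stepFun]
  linarith

end Sequences

variable {H : Type*} [NormedAddCommGroup H] [InnerProductSpace ℝ H] [CompleteSpace H]
  {φ : H → ℝ} {u : ℝ → H}

/-- A solution which becomes stationary has vanishing gradient in the limit. -/
theorem IsSolution.liminf_gradient_eq_zero (hφ : ContDiff ℝ 1 φ) (hu : IsSolution φ u) {L : ℝ}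
    (hL : 0 ≤ L) (h : ∀ t, L ≤ t → u t = u L) :
    liminf (fun t : ℝ => ‖gradient φ (u t)‖ₑ) atTop = 0 := by
  have h0 : ∀ᶠ t in atTop, ‖gradient φ (u t)‖ₑ = 0 := by
    filter_upwards [eventually_gt_atTop L] with t ht
    rw [hu.gradient_eq_zero_of_energy_eq hφ hL ht (by rw [h t ht.le]) t (right_mem_Icc.2 ht.le)]
    simp
  rw [liminf_congr h0]
  simp

theorem frequently_gradient_lt (h : liminf (fun t : ℝ => ‖gradient φ (u t)‖ₑ) atTop = 0) {ε : ℝ}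
    (hε : 0 < ε) : ∃ᶠ t in atTop, ‖gradient φ (u t)‖ < ε := by
  have := frequently_lt_of_liminf_lt (f := atTop) (u := fun t : ℝ => ‖gradient φ (u t)‖ₑ)
    (b := ENNReal.ofReal ε) (by isBoundedDefault) (by rw [h]; simpa using hε)
  refine this.mono fun t ht => ?_
  rwa [← ofReal_norm, ENNReal.ofReal_lt_ofReal_iff hε] at ht

/-- The scales along which samples confine the discrete solutions. -/
theorem IsSolution.exists_scales (hφ : ContDiff ℝ 1 φ) (hlow : QuadraticLowerBound φ)
    (hu : IsSolution φ u) :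
    ∃ ε S : ℝ → ℝ, (∀ τ, 0 < ε τ ∧ 0 < S τ) ∧ Tendsto ε (𝓝[>] 0) (𝓝 0) ∧
      Tendsto S (𝓝[>] 0) atTop ∧ (∀ᶠ τ in 𝓝[>] (0 : ℝ), StepsFollow φ u (ε τ) τ (S τ)) ∧
      (liminf (fun t : ℝ => ‖gradient φ (u t)‖ₑ) atTop = 0 →
        ∀ᶠ τ in 𝓝[>] (0 : ℝ), ‖gradient φ (u (numSteps τ (S τ) * τ))‖ ≤ ε τ) := by
  set Z : Prop := liminf (fun t : ℝ => ‖gradient φ (u t)‖ₑ) atTop = 0 with hZ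
  set e : ℕ → ℝ := fun n => 1 / ((n : ℝ) + 1) with he
  have he0 : ∀ n, 0 < e n := fun n => Nat.one_div_pos_of_nat
  have hS : ∀ n : ℕ, ∃ s : ℝ, (n : ℝ) + 1 ≤ s ∧ (Z → ‖gradient φ (u s)‖ < e n) := fun n => by
    by_cases hz : Z
    · obtain ⟨s, hs1, hs2⟩ := ((frequently_gradient_lt hz (he0 n)).and_eventually
        (eventually_ge_atTop ((n : ℝ) + 1))).exists
      exact ⟨s, hs2, fun _ => hs1⟩
    · exact ⟨_, le_rfl, fun h => absurd h hz⟩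
  choose s hs hsZ using hS
  have hspos : ∀ n, 0 < s n := fun n => lt_of_lt_of_le (by positivity) (hs n)
  have hP : ∀ n, ∀ᶠ τ in 𝓝[>] (0 : ℝ), StepsFollow φ u (e n) τ (s n) ∧
      (Z → ‖gradient φ (u (numSteps τ (s n) * τ))‖ ≤ e n) := fun n => by
    refine (hu.eventually_stepsFollow hφ hlow (he0 n) (hspos n)).and ?_
    by_cases hz : Z
    · have hc := (hu.continuousOn_gradient hφ).norm.continuousAt (Ici_mem_nhds (hspos n))
      -- The last sampling time overshoots `s n` by less than `τ`, so the strict gradient bound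
      -- survives by continuity.
      obtain ⟨r, hr, hball⟩ := Metric.eventually_nhds_iff.1 (hc.eventually_lt_const (hsZ n hz))
      filter_upwards [self_mem_nhdsWithin, mem_nhdsWithin_of_mem_nhds (Iio_mem_nhds hr)]
        with τ hτ hτr _
      have h1 := le_numSteps_mul hτ (s n)
      have h2 := numSteps_mul_lt hτ (hspos n)
      refine (hball ?_).le
      rw [Real.dist_eq, abs_of_nonneg (by linarith)]
      linarith [show τ < r from hτr]
    · exact Eventually.of_forall fun _ h => absurd h hz
  obtain ⟨ν, hν, hPν⟩ := exists_tendsto_atTop_of_forall_eventually hP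
  refine ⟨fun τ => e (ν τ), fun τ => s (ν τ), fun τ => ⟨he0 _, hspos _⟩,
    tendsto_one_div_add_atTop_nhds_zero_nat.comp hν, ?_, hPν.mono fun _ h => h.1,
    fun hz => hPν.mono fun _ h => h.2 hz⟩
  refine tendsto_atTop_mono (fun τ => ?_) (tendsto_natCast_atTop_atTop.comp hν)
  simp only [Function.comp]
  linarith [hs (ν τ)]

/-! ### Existence and closeness of discrete solutions of the penalized scheme. -/

section Approximation

variable {ε S : ℝ → ℝ}

theorem IsMinimalSolution.eventually_DSFin (hφ : ContDiff ℝ 1 φ) (hu : IsMinimalSolution φ u)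
    (hεpos : ∀ τ, 0 < ε τ) (hε : Tendsto ε (𝓝[>] 0) (𝓝 0))
    (hS : Tendsto S (𝓝[>] 0) atTop)
    (hfollow : ∀ᶠ τ in 𝓝[>] (0 : ℝ), StepsFollow φ u (ε τ) τ (S τ))
    (hend : liminf (fun t : ℝ => ‖gradient φ (u t)‖ₑ) atTop = 0 →
      ∀ᶠ τ in 𝓝[>] (0 : ℝ), ‖gradient φ (u (numSteps τ (S τ) * τ))‖ ≤ ε τ)
    {T η : ℝ} (hT : 0 < T) (hη : 0 < η) :
    ∀ᶠ τ in 𝓝[>] (0 : ℝ),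
      (DSFin τ (penalized φ u (12 * ε τ) τ (S τ)) (u 0) T).Nonempty ∧
      ∀ U ∈ DSFin τ (penalized φ u (12 * ε τ) τ (S τ)) (u 0) T, ∀ t ∈ Icc 0 T,
        ‖u t - U t‖ ≤ η := by
  have hend' : (∀ᶠ τ in 𝓝[>] (0 : ℝ), ‖gradient φ (u (numSteps τ (S τ) * τ))‖ ≤ ε τ) ∨
      ∀ L, 0 ≤ L → ∃ t, L ≤ t ∧ u t ≠ u L := by
    by_cases h : ∀ L, 0 ≤ L → ∃ t, L ≤ t ∧ u t ≠ u L
    · exact Or.inr h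
    · push Not at h
      obtain ⟨L, hL, h⟩ := h
      exact Or.inl (hend (hu.1.liminf_gradient_eq_zero hφ hL h))
  obtain ⟨M, hM, hMb⟩ := hu.1.exists_gradient_le hφ (T + 1)
  have hMτ : ∀ᶠ τ in 𝓝[>] (0 : ℝ), M * τ < η / 2 := by
    have : Continuous fun τ : ℝ => M * τ := by fun_prop
    have h := this.tendsto 0
    rw [mul_zero] at h
    exact (h.mono_left nhdsWithin_le_nhds).eventually_lt_const (half_pos hη)
  filter_upwards [self_mem_nhdsWithin, hMτ,
    hu.eventually_tracking hφ hεpos hε hS hfollow hend' hT (half_pos hη),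
    (mem_nhdsWithin_of_mem_nhds (Iio_mem_nhds one_pos) : Iio 1 ∈ 𝓝[>] (0 : ℝ))]
    with τ hτ hMτ htrack hτ1
  have hτ : 0 < τ := hτ
  have hτ1 : τ < 1 := hτ1
  refine ⟨DSFin_nonempty hτ (V := stepSeq τ (penalized φ u (12 * ε τ) τ (S τ)) (u 0))
    ⟨rfl, fun n => ?_⟩, fun U hU t ht => ?_⟩
  -- Tracking also provides a next step after any minimizing beginning, so `stepSeq` keeps making
  -- genuine steps up to the horizon.
  · induction n using Nat.strong_induction_on with
    | _ n ih =>
      exact fun hn => isMinStep_stepSeq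
        (htrack n hn.le _ rfl fun k hk => ih k hk (hk.trans hn)).2
  · refine (norm_sub_le_of_mem_DSFin hτ (half_pos hη).le hM.le
      (fun m hm V h0 hV => (htrack m hm V h0 hV).1) (fun a b ha hab hb => ?_) hU ht).trans
        (by linarith)
    exact hu.1.norm_sub_le ha hab fun r hr => hMb r ⟨ha.trans hr.1, by linarith [hr.2]⟩

/-- The sequence never leaves the samples: from each one a step exists and ends in a sample, and the
almost critical last one is absorbing. -/
theorem StepsFollow.exists_isStep_stepSeq {ε τ S : ℝ} (h : StepsFollow φ u ε τ S)
    (hend : ‖gradient φ (u (numSteps τ S * τ))‖ ≤ ε) (n : ℕ) :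
    ∃ V, IsStep τ (penalized φ u (12 * ε) τ S)
      (stepSeq τ (penalized φ u (12 * ε) τ S) (u 0) n) V := by
  have hex : ∀ k ≤ numSteps τ S, ∃ V, IsStep τ (penalized φ u (12 * ε) τ S) (u (k * τ)) V := by
    intro k hk
    rcases hk.lt_or_eq with hk | rfl
    · exact h.exists_isStep k hk
    · exact h.exists_isStep_final hend
  suffices hs : ∃ k ≤ numSteps τ S,
      stepSeq τ (penalized φ u (12 * ε) τ S) (u 0) n = u (k * τ) by
    obtain ⟨k, hk, hs⟩ := hs
    rw [hs]
    exact hex k hk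
  induction n with
  | zero => exact ⟨0, Nat.zero_le _, by simp [stepSeq]⟩
  | succ n ih =>
    obtain ⟨k, hk, hs⟩ := ih
    have hstep : IsStep τ (penalized φ u (12 * ε) τ S)
        (stepSeq τ (penalized φ u (12 * ε) τ S) (u 0) n) _ :=
      isMinStep_stepSeq (by rw [hs]; exact hex k hk)
    rw [hs] at hstep
    rcases hk.lt_or_eq with hk | rfl
    · obtain ⟨k', -, hk', hV, -⟩ := h.eq_of_isStep k hk _ hstep
      exact ⟨k', hk', hV⟩
    · exact ⟨_, le_rfl, h.eq_of_isStep_final hend _ hstep⟩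

end Approximation

/-- The penalized functionals approximate a minimal solution. -/
theorem IsMinimalSolution.exists_penalized (hφ : ContDiff ℝ 1 φ) (hlow : QuadraticLowerBound φ)
    (hu : IsMinimalSolution φ u) :
    ∃ c S : ℝ → ℝ, (∀ τ : ℝ, 0 < τ → 0 < c τ ∧ 0 < S τ) ∧
      Tendsto c (𝓝[>] 0) (𝓝 0) ∧ Tendsto S (𝓝[>] 0) atTop ∧
      StronglyApproximatesOnCompacts φ u (fun τ => penalized φ u (c τ) τ (S τ)) ∧
      ((FiniteDimensional ℝ H ∨
          liminf (fun t : ℝ => ‖gradient φ (u t)‖ₑ) atTop = 0) →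
        StronglyApproximates φ u (fun τ => penalized φ u (c τ) τ (S τ))) := by
  obtain ⟨ε, S, hpos, hε, hS, hfollow, hend⟩ := hu.1.exists_scales hφ hlow
  have hεpos := fun τ => (hpos τ).1
  refine ⟨fun τ => 12 * ε τ, S, fun τ _ => ⟨by linarith [hεpos τ], (hpos τ).2⟩,
    by simpa using hε.const_mul 12, hS, ⟨⟨1, one_pos, fun τ _ => ?_⟩,
      tendsto_lip_penalized φ u hεpos hε, fun T hT => ?_⟩,
    fun hcase => ⟨tendsto_lip_penalized φ u hεpos hε, ?_⟩⟩
  · exact (lip_penalized_le φ u (by linarith [hεpos τ]) τ (S τ)).trans_lt ENNReal.ofReal_lt_top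
  · refine tendsto_zero_of_eventually_le_ofReal fun η hη => ?_
    filter_upwards [hu.eventually_DSFin hφ hεpos hε hS hfollow hend hT hη] with τ h
    exact DFin_le h.1 h.2
  · have hne : ∀ᶠ τ in 𝓝[>] (0 : ℝ),
        (DS τ (penalized φ u (12 * ε τ) τ (S τ)) (u 0)).Nonempty := by
      rcases hcase with hfin | hlim
      · have : ProperSpace H := FiniteDimensional.proper_real H
        filter_upwards [self_mem_nhdsWithin, hlow.eventually_exists_isStep hφ.continuous]
          with τ hτ hex
        refine DS_nonempty hτ (V := stepSeq τ (penalized φ u (12 * ε τ) τ (S τ)) (u 0))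
          ⟨rfl, fun k => isMinStep_stepSeq ?_⟩
        have := hεpos τ
        exact hex (fun z => 12 * ε τ * Metric.infDist z (sampledRange u τ (S τ)))
          (by fun_prop) (fun z => mul_nonneg (by positivity) Metric.infDist_nonneg) _
      · filter_upwards [self_mem_nhdsWithin, hfollow, hend hlim] with τ hτ hf he
        exact DS_nonempty hτ (V := stepSeq τ (penalized φ u (12 * ε τ) τ (S τ)) (u 0))
          ⟨rfl, fun k => isMinStep_stepSeq (hf.exists_isStep_stepSeq he k)⟩
    refine tendsto_zero_of_eventually_le_ofReal fun η hη => ?_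
    -- The horizon `1 / η` makes the tail contribution at most `η`.
    filter_upwards [hne, hu.eventually_DSFin hφ hεpos hε hS hfollow hend (one_div_pos.2 hη) hη]
      with τ hne h
    exact DInf_le hne (one_div_pos.2 hη) (one_div_one_div η).le
      fun U hU => h.2 U (DS_subset_DSFin _ _ _ _ hU)

end Convergence

end MinMov

theorem theorem4p8 {H : Type*} [NormedAddCommGroup H] [InnerProductSpace ℝ H] [CompleteSpace H]
    (φ : H → ℝ) (hφ : ContDiff ℝ 1 φ) (hlow : MinMov.QuadraticLowerBound φ)
    (u : ℝ → H) (hu : MinMov.IsMinimalSolution φ u) :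
    MinMov.IsStronglyApproximableOnCompacts φ u ∧
    ((FiniteDimensional ℝ H ∨
        Filter.liminf (fun t : ℝ => ‖gradient φ (u t)‖ₑ) Filter.atTop = 0) →
      MinMov.IsStronglyApproximable φ u) ∧
    ∃ c S : ℝ → ℝ, (∀ τ : ℝ, 0 < τ → 0 < c τ ∧ 0 < S τ) ∧
      Filter.Tendsto c (nhdsWithin 0 (Set.Ioi 0)) (nhds 0) ∧
      Filter.Tendsto S (nhdsWithin 0 (Set.Ioi 0)) Filter.atTop ∧
      MinMov.StronglyApproximatesOnCompacts φ u
        (fun τ => MinMov.penalized φ u (c τ) τ (S τ)) ∧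
      ((FiniteDimensional ℝ H ∨
          Filter.liminf (fun t : ℝ => ‖gradient φ (u t)‖ₑ) Filter.atTop = 0) →
        MinMov.StronglyApproximates φ u
          (fun τ => MinMov.penalized φ u (c τ) τ (S τ))) := by
  obtain ⟨c, S, hpos, hc, hS, hcomp, hglob⟩ := hu.exists_penalized hφ hlow
  exact ⟨⟨hu.1, _, hcomp⟩, fun h => ⟨hu.1, _, hglob h⟩, c, S, hpos, hc, hS, hcomp, hglob⟩
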